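/- **Setting.** Let $N\ge 0$ and, for $i=1,\dots,N$, let $J_i\subseteq\mathbb R$ be an open set closed under decreasing its elements (an open half-line $(-\infty,a_i)$, the whole line, or empty). Let $f^i:J_i\to\mathbb C$ be nowhere vanishing functions of class $C^1$ and let $\sqrt{f^i}$ denote a continuous square root of $f^i$ on $J_i$. For a matrix function $F_{ij}(x,y)$, defined for $-x\in J_i$, $-y\in J_j$, with complex values, consider $$F_{ij}(s-u^i,s'-u^j)\qquad\text{and}\qquad \widetilde F_{ij}(s-u^i,s'-u^j)=\frac{\sqrt{f^j(u^j-s')}}{\sqrt{f^i(u^i-s)}}\,F_{ij}(s-u^i,s'-u^j)\qquad(u^i-s\in J_i,\ u^j-s'\in J_j)$$ as matrix functions $\mathcal F_{ij}(s,s',u)$. A matrix function $\mathcal F_{ij}(s,s',u)$ satisfies the *Zakharov differential relation* if, for all $i,j$ (equal or not), $$\frac{\partial \mathcal F_{ij}(s,s',u)}{\partial s'}+\frac{\partial \mathcal F_{ji}(s',s,u)}{\partial s}=0 .$$ **Part 1.** Assume that $F_{ij}(x,y)$ is of class $C^2$ and $F_{ij}(x,y)\sqrt{f^j(-y)}$ of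 class $C^1$, and that both decay at $+\infty$ in the following sense: on every closed quadrant $x\ge x_0$, $y\ge y_0$ contained in the domain, the derivatives of order $\le 2$ (respectively $\le 1$) are bounded by $m(x)b(y)$, where $m$ on $[x_0,\infty)$ and $b$ on $[y_0,\infty)$ are nonincreasing and integrable. Assume that both $F_{ij}(s-u^i,s'-u^j)$ and $\widetilde F_{ij}(s-u^i,s'-u^j)$ satisfy the Zakharov differential relation. Let $W\subseteq\mathbb R\times\mathbb R^N$ be an open set such that $u^i-s\in J_i$ for all $i$ and all $(s,u)\in W$, and suppose that for each $(s,u)\in W$ the matrix function $s'\mapsto K_{ij}(s,s',u)$, $s'\ge s$, is the unique bounded continuous solution on $[s,\infty)$ of the linear integral equation $$K_{ij}(s,s',u)=F_{ij}(s-u^i,s'-u^j)+\int_s^\infty\sum_l K_{il}(s,q,u)\,F_{lj}(q-u^l,s'-u^j)\,dq .$$ Put $\beta_{ij}(s,u)=K_{ji}(s,s,u)$. Then, at every $(s,u)\in W$, the functions $\beta_{ij}(s,\cdot)$ are differentiable in $u$ and satisfy $$\frac{\partial\beta_{ij}}{\partial u^k}=\beta_{ik}\beta_{kj}\qquad (i\ne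 j,\ i\ne k,\ j\ne k),$$ $$\frac{\partial\beta_{ij}}{\partial u^i}+\frac{\partial\beta_{ji}}{\partial u^j}+\sum_{l\ne i,\,l\ne j}\beta_{li}\beta_{lj}=0\qquad(i\ne j),$$ $$\sqrt{f^i_s(u^i)}\,\frac{\partial\bigl(\sqrt{f^i_s(u^i)}\,\beta_{ij}\bigr)}{\partial u^i}+\sqrt{f^j_s(u^j)}\,\frac{\partial\bigl(\sqrt{f^j_s(u^j)}\,\beta_{ji}\bigr)}{\partial u^j}+\sum_{l\ne i,\,l\ne j}f^l_s(u^l)\,\beta_{li}\beta_{lj}=0\qquad(i\ne j),$$ where $f^i_s(x)=f^i(x-s)$ and $\sqrt{f^i_s(x)}=\sqrt{f^i}(x-s)$. In particular, for $s=0$ this is the system with the functions $f^i(u^i)$ themselves. **Part 2.** Let $\Phi_{ij}(x,y)$, $i\le j$, be functions of class $C^2$ on $-x\in J_i$, $-y\in J_j$, with $\Phi_{ii}(x,y)=-\Phi_{ii}(y,x)$, and let $F$ be a matrix function generated by them: $$F_{ij}(s-u^i,s'-u^j)=\frac{\partial\Phi_{ij}(s-u^i,s'-u^j)}{\partial s}\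 (i\le j),\qquad F_{ji}(s-u^j,s'-u^i)=-\frac{\partial\Phi_{ij}(s'-u^i,s-u^j)}{\partial s}\ (i<j).$$ Then $F_{ij}(s-u^i,s'-u^j)$ satisfies the Zakharov differential relation, and $\widetilde F_{ij}(s-u^i,s'-u^j)$ satisfies it if and only if the linear equations $$2\frac{\partial^2\Phi_{ij}}{\partial u^i\partial u^j}\bigl(f^i(u^i-s)-f^j(u^j-s')\bigr)+\frac{\partial\Phi_{ij}}{\partial u^j}\frac{d f^i(u^i-s)}{du^i}-\frac{\partial\Phi_{ij}}{\partial u^i}\frac{d f^j(u^j-s')}{du^j}=0\quad(i<j),\qquad \Phi_{ij}=\Phi_{ij}(s-u^i,s'-u^j),$$ $$2\frac{\partial^2\Phi_{ii}}{\partial s\,\partial s'}\bigl(f^i(u^i-s)-f^i(u^i-s')\bigr)-\frac{\partial\Phi_{ii}}{\partial s}\frac{d f^i(u^i-s')}{ds'}+\frac{\partial\Phi_{ii}}{\partial s'}\frac{d f^i(u^i-s)}{ds}=0,\qquad \Phi_{ii}=\Phi_{ii}(s-u^i,s'-u^i),$$ hold for all $u,s,s'$ with $u^i-s\in J_i$,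 $u^j-s'\in J_j$ (with $j=i$ in the second equation). -/

import Mathlib

open Set MeasureTheory

noncomputable section

/-- The partial derivative `∂φ/∂uᵏ` at the point `u`. -/
def pd {N : ℕ} (k : Fin N) (φ : (Fin N → ℝ) → ℂ) (u : Fin N → ℝ) : ℂ :=
  deriv (fun t : ℝ => φ (Function.update u k t)) (u k)

/-- First part of the Lamé equations at the point `u`:
`∂β_ij/∂uᵏ = β_ik β_kj` for pairwise distinct `i, j, k`. -/
def Lame1 {N : ℕ} (β : Fin N → Fin N → (Fin N → ℝ) → ℂ) (u : Fin N → ℝ) : Prop :=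
  ∀ i j k : Fin N, i ≠ j → i ≠ k → j ≠ k → pd k (β i j) u = β i k u * β k j u

/-- Second part of the Lamé equations at the point `u`:
`∂β_ij/∂uⁱ + ∂β_ji/∂uʲ + ∑_{l ≠ i, j} β_li β_lj = 0` for `i ≠ j`. -/
def Lame2 {N : ℕ} (β : Fin N → Fin N → (Fin N → ℝ) → ℂ) (u : Fin N → ℝ) : Prop :=
  ∀ i j : Fin N, i ≠ j →
    pd i (β i j) u + pd j (β j i) u
      + ∑ l : Fin N with l ≠ i ∧ l ≠ j, β l i u * β l j u = 0

/-- The additional reduction of the Lamé equations attached to functions `fⁱ` of one variable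
with square roots `rⁱ = √fⁱ`, at the point `u`:
`√fⁱ ∂(√fⁱ β_ij)/∂uⁱ + √fʲ ∂(√fʲ β_ji)/∂uʲ + ∑_{l ≠ i, j} fˡ β_li β_lj = 0` for `i ≠ j`,
with `fⁱ = fⁱ(uⁱ)`. -/
def Lame3 {N : ℕ} (f r : Fin N → ℝ → ℂ) (β : Fin N → Fin N → (Fin N → ℝ) → ℂ)
    (u : Fin N → ℝ) : Prop :=
  ∀ i j : Fin N, i ≠ j →
    r i (u i) * pd i (fun w => r i (w i) * β i j w) u
      + r j (u j) * pd j (fun w => r j (w j) * β j i w) u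
      + ∑ l : Fin N with l ≠ i ∧ l ≠ j, f l (u l) * β l i u * β l j u = 0

/-- The dressing matrix function `F_ij(s - uⁱ, s' - uʲ)`. -/
def dressing {N : ℕ} (F : Fin N → Fin N → ℝ → ℝ → ℂ)
    (i j : Fin N) (s s' : ℝ) (u : Fin N → ℝ) : ℂ :=
  F i j (s - u i) (s' - u j)

/-- The rescaled dressing matrix function
`(√fʲ(uʲ - s') / √fⁱ(uⁱ - s)) F_ij(s - uⁱ, s' - uʲ)`, where `rⁱ = √fⁱ`. -/
def rescaledDressing {N : ℕ} (r : Fin N → ℝ → ℂ) (F : Fin N → Fin N → ℝ → ℝ → ℂ)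
    (i j : Fin N) (s s' : ℝ) (u : Fin N → ℝ) : ℂ :=
  r j (u j - s') / r i (u i - s) * F i j (s - u i) (s' - u j)

/-- The Zakharov differential relation
`∂𝓕_ij(s, s', u)/∂s' + ∂𝓕_ji(s', s, u)/∂s = 0` for all `i, j` (equal or not), on the region
`uⁱ - s ∈ Jⁱ`, `uʲ - s' ∈ Jʲ`. -/
def ZakharovRelation {N : ℕ} (J : Fin N → Set ℝ)
    (𝓕 : Fin N → Fin N → ℝ → ℝ → (Fin N → ℝ) → ℂ) : Prop :=
  ∀ (i j : Fin N) (u : Fin N → ℝ) (s s' : ℝ), u i - s ∈ J i → u j - s' ∈ J j →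
    deriv (fun t : ℝ => 𝓕 i j s t u) s' + deriv (fun t : ℝ => 𝓕 j i s' t u) s = 0

/-- The region `-x ∈ A`, `-y ∈ B` of the plane. -/
def quadrant (A B : Set ℝ) : Set (ℝ × ℝ) := {p | -p.1 ∈ A ∧ -p.2 ∈ B}

/-- `H` is of class `Cⁿ` on the region `-x ∈ A`, `-y ∈ B`, and on every closed quadrant
`x ≥ x₀`, `y ≥ y₀` of that region its derivatives of order at most `n` are bounded by
`m(x) b(y)` with `m`, `b` nonincreasing and integrable. -/
def Decays (n : ℕ) (A B : Set ℝ) (H : ℝ × ℝ → ℂ) : Prop :=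
  ContDiffOn ℝ n H (quadrant A B) ∧
  ∀ x₀ y₀ : ℝ, -x₀ ∈ A → -y₀ ∈ B →
    ∃ m b : ℝ → ℝ, AntitoneOn m (Ici x₀) ∧ IntegrableOn m (Ici x₀) ∧
      AntitoneOn b (Ici y₀) ∧ IntegrableOn b (Ici y₀) ∧
      ∀ k ≤ n, ∀ x ≥ x₀, ∀ y ≥ y₀, ‖iteratedFDeriv ℝ k H (x, y)‖ ≤ m x * b y

/-- For a fixed value of `u` (hidden in the kernel `𝓕`) and of `s`: the matrix function
`k_ij(s') = K_ij(s, s', u)`, `s' ≥ s`, is a bounded continuous solution of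
`K_ij(s, s') = 𝓕_ij(s, s') + ∫_s^∞ ∑_l K_il(s, q) 𝓕_lj(q, s') dq`. -/
structure IsGLMSolution {N : ℕ} (𝓕 : Fin N → Fin N → ℝ → ℝ → ℂ) (s : ℝ)
    (k : Fin N → Fin N → ℝ → ℂ) : Prop where
  continuousOn : ∀ i j, ContinuousOn (k i j) (Ici s)
  bounded : ∃ C : ℝ, ∀ i j, ∀ s' ≥ s, ‖k i j s'‖ ≤ C
  equation : ∀ i j, ∀ s' ≥ s,
    k i j s' = 𝓕 i j s s' + ∫ q in Ioi s, ∑ l : Fin N, k i l q * 𝓕 l j q s'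

/-- `k` is the unique bounded continuous solution on `[s, ∞)`. -/
def IsUniqueGLMSolution {N : ℕ} (𝓕 : Fin N → Fin N → ℝ → ℝ → ℂ) (s : ℝ)
    (k : Fin N → Fin N → ℝ → ℂ) : Prop :=
  IsGLMSolution 𝓕 s k ∧
  ∀ k' : Fin N → Fin N → ℝ → ℂ, IsGLMSolution 𝓕 s k' →
    ∀ i j, ∀ s' ≥ s, k' i j s' = k i j s'

/-- `β_ij(s, u) = K_ji(s, s, u)`. -/
def rotationCoeff {N : ℕ} (K : Fin N → Fin N → ℝ → ℝ → (Fin N → ℝ) → ℂ) (s : ℝ)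
    (i j : Fin N) (u : Fin N → ℝ) : ℂ :=
  K j i s s u

/-- The functions `Φ_ij`, `i ≤ j`, of class `C²`, with `Φ_ii` skew-symmetric, generate `F`:
`F_ij(s - uⁱ, s' - uʲ) = ∂Φ_ij(s - uⁱ, s' - uʲ)/∂s` for `i ≤ j` and
`F_ji(s - uʲ, s' - uⁱ) = -∂Φ_ij(s' - uⁱ, s - uʲ)/∂s` for `i < j`.
The values of `Φ_ij` for `i > j` play no role. -/
structure Generates {N : ℕ} (J : Fin N → Set ℝ) (Φ F : Fin N → Fin N → ℝ → ℝ → ℂ) : Prop where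
  smooth : ∀ i j, i ≤ j →
    ContDiffOn ℝ 2 (fun p : ℝ × ℝ => Φ i j p.1 p.2) (quadrant (J i) (J j))
  skew : ∀ i, ∀ x y : ℝ, -x ∈ J i → -y ∈ J i → Φ i i x y = - Φ i i y x
  upper : ∀ i j, i ≤ j → ∀ (u : Fin N → ℝ) (s s' : ℝ), u i - s ∈ J i → u j - s' ∈ J j →
    F i j (s - u i) (s' - u j) = deriv (fun t : ℝ => Φ i j (t - u i) (s' - u j)) s
  lower : ∀ i j, i < j → ∀ (u : Fin N → ℝ) (s s' : ℝ), u j - s ∈ J j → u i - s' ∈ J i →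
    F j i (s - u j) (s' - u i) = - deriv (fun t : ℝ => Φ i j (s' - u i) (t - u j)) s

/-- The linear equations for the off-diagonal generating functions, `i < j`:
`2 ∂²Φ_ij/∂uⁱ∂uʲ (fⁱ(uⁱ - s) - fʲ(uʲ - s')) + ∂Φ_ij/∂uʲ dfⁱ(uⁱ - s)/duⁱ
  - ∂Φ_ij/∂uⁱ dfʲ(uʲ - s')/duʲ = 0`, with `Φ_ij = Φ_ij(s - uⁱ, s' - uʲ)`. -/
def LinearOffDiag {N : ℕ} (J : Fin N → Set ℝ) (f : Fin N → ℝ → ℂ)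
    (Φ : Fin N → Fin N → ℝ → ℝ → ℂ) : Prop :=
  ∀ i j : Fin N, i < j → ∀ (u : Fin N → ℝ) (s s' : ℝ), u i - s ∈ J i → u j - s' ∈ J j →
    2 * pd i (pd j (fun w => Φ i j (s - w i) (s' - w j))) u
        * (f i (u i - s) - f j (u j - s'))
      + pd j (fun w => Φ i j (s - w i) (s' - w j)) u * deriv (fun t : ℝ => f i (t - s)) (u i)
      - pd i (fun w => Φ i j (s - w i) (s' - w j)) u * deriv (fun t : ℝ => f j (t - s')) (u j)
      = 0

/-- The linear equations for the diagonal generating functions: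
`2 ∂²Φ_ii/∂s∂s' (fⁱ(uⁱ - s) - fⁱ(uⁱ - s')) - ∂Φ_ii/∂s dfⁱ(uⁱ - s')/ds'
  + ∂Φ_ii/∂s' dfⁱ(uⁱ - s)/ds = 0`, with `Φ_ii = Φ_ii(s - uⁱ, s' - uⁱ)`. -/
def LinearDiag {N : ℕ} (J : Fin N → Set ℝ) (f : Fin N → ℝ → ℂ)
    (Φ : Fin N → Fin N → ℝ → ℝ → ℂ) : Prop :=
  ∀ (i : Fin N) (u : Fin N → ℝ) (s s' : ℝ), u i - s ∈ J i → u i - s' ∈ J i →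
    2 * deriv (fun x : ℝ => deriv (fun y : ℝ => Φ i i (x - u i) (y - u i)) s') s
        * (f i (u i - s) - f i (u i - s'))
      - deriv (fun x : ℝ => Φ i i (x - u i) (s' - u i)) s
        * deriv (fun y : ℝ => f i (u i - y)) s'
      + deriv (fun y : ℝ => Φ i i (s - u i) (y - u i)) s'
        * deriv (fun x : ℝ => f i (u i - x)) s
      = 0

end

/-!
*Differentiability.* For fixed `u` and a row index `i`, the integral equation reads `k = g + T k`
with `T` a compact operator on bounded continuous functions, because the kernel decays. Uniqueness
of the solution makes `1 - T` injective, hence invertible by the Fredholm alternative, and `T` and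
`g` are differentiable in `u`, hence so is the solution.

*The Lamé equations.* The derivative of the `i`-th row along `uᵐ`, `m ≠ i`, and the combination
`k_im · (m-th row) - (∂/∂s' of the m-th entry of the i-th row)` solve the same linear equation
(integrate by parts in the derivative of the kernel), so they agree; evaluating at `s' = s` gives
`∂β_ij/∂uᵏ = β_ik β_kj`, and a formula for `∂β_ij/∂uⁱ`. The Zakharov relation for the rescaled
kernel says that the `s'`-derivative of `√fʲ F_ij`, weighted by `√fʲ`, is skew-symmetric. Pairing
the equations of two rows `i ≠ j` against it, the double integrals cancel, and what remains is a
quadratic relation between boundary values at `s' = s`: with the formula for `∂β_ij/∂uⁱ` it is the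
last Lamé equation, and the second one is the case `√f = 1`.

*Generating functions.* The Zakharov relation for `F` is the equality of the mixed partial
derivatives of `Φ`, and the relation for the rescaled kernel, multiplied by `-2 √fⁱ √fʲ`, is the
linear equation.
-/

noncomputable section

open Filter Topology

section Calculus

lemma hasDerivAt_of_sq_eq {J : Set ℝ} (hJ : IsOpen J) {f r : ℝ → ℂ} (hr : ContinuousOn r J)
    (hsq : ∀ x ∈ J, r x ^ 2 = f x) {x : ℝ} (hx : x ∈ J) (hne : r x ≠ 0) {f' : ℂ}
    (hf : HasDerivAt f f' x) : HasDerivAt r (f' / (2 * r x)) x := by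
  have hsum : Tendsto (fun y => r y + r x) (𝓝 x) (𝓝 (2 * r x)) := by
    rw [two_mul]
    exact (hr.continuousAt (hJ.mem_nhds hx)).tendsto.add tendsto_const_nhds
  have hne' : 2 * r x ≠ 0 := mul_ne_zero two_ne_zero hne
  rw [hasDerivAt_iff_tendsto_slope] at hf ⊢
  refine (hf.div (hsum.mono_left nhdsWithin_le_nhds) hne').congr' ?_
  filter_upwards [nhdsWithin_le_nhds (hJ.mem_nhds hx),
    nhdsWithin_le_nhds (hsum.eventually_ne hne')] with y hy hy'
  rw [Pi.div_apply, div_eq_iff hy', slope, slope, vsub_eq_sub, vsub_eq_sub, smul_mul_assoc,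
    ← hsq y hy, ← hsq x hx]
  congr 1
  ring

variable {E F : Type*} [NormedAddCommGroup E] [NormedSpace ℝ E] [NormedAddCommGroup F]
  [NormedSpace ℝ F]

lemma hasFDerivAt_of_eventually_norm_sub_le_sq {f : E → F} {f' : E →L[ℝ] F} {x : E} {C : ℝ}
    (h : ∀ᶠ y in 𝓝 x, ‖f y - f x - f' (y - x)‖ ≤ C * ‖y - x‖ ^ 2) : HasFDerivAt f f' x := by
  refine .of_isLittleO ((Asymptotics.IsBigO.of_bound C ?_).trans_isLittleO
    (Asymptotics.isLittleO_pow_sub_sub x one_lt_two))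
  filter_upwards [h] with y hy using by simpa using hy

lemma norm_sub_sub_fderiv_le_of_norm_fderiv_fderiv_le {S : Set E} (hS : Convex ℝ S) {f : E → F}
    {C : ℝ} (hf : ∀ x ∈ S, ContDiffAt ℝ 2 f x)
    (hC : ∀ x ∈ S, ‖fderiv ℝ (fderiv ℝ f) x‖ ≤ C) {x y : E} (hx : x ∈ S) (hy : y ∈ S) :
    ‖f y - f x - fderiv ℝ f x (y - x)‖ ≤ C * ‖y - x‖ ^ 2 := by
  have hseg : segment ℝ x y ⊆ S := hS.segment_subset hx hy
  have hbound : ∀ z ∈ segment ℝ x y, ‖fderiv ℝ f z - fderiv ℝ f x‖ ≤ C * ‖y - x‖ := by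
    intro z hz
    have hd : ∀ z ∈ S, DifferentiableAt ℝ (fderiv ℝ f) z := fun z hz =>
      ((hf z hz).fderiv_right (m := 1) (by norm_num)).differentiableAt one_ne_zero
    refine (hS.norm_image_sub_le_of_norm_fderiv_le hd hC hx (hseg hz)).trans ?_
    exact mul_le_mul_of_nonneg_left (norm_sub_le_of_mem_segment hz)
      ((norm_nonneg (fderiv ℝ (fderiv ℝ f) x)).trans (hC x hx))
  have := (convex_segment x y).norm_image_sub_le_of_norm_fderiv_le' (𝕜 := ℝ)
    (fun z hz => (hf z (hseg hz)).differentiableAt two_ne_zero) hbound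
    (left_mem_segment ℝ x y) (right_mem_segment ℝ x y)
  rwa [mul_assoc, ← sq] at this

lemma integral_Ioi_eq_neg_of_hasDerivAt_of_integrableOn [CompleteSpace F] {f f' : ℝ → F} {a : ℝ}
    (hderiv : ∀ x ∈ Ici a, HasDerivAt f (f' x) x) (hf' : IntegrableOn f' (Ioi a))
    (hf : IntegrableOn f (Ioi a)) : ∫ x in Ioi a, f' x = -f a := by
  have hlim : Tendsto f atTop (𝓝 0) :=
    tendsto_zero_of_hasDerivAt_of_integrableOn_Ioi (fun x hx => hderiv x hx.out.le) hf' hf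
  simpa using integral_Ioi_of_hasDerivAt_of_tendsto' hderiv hf' hlim

end Calculus

section PlaneDerivatives

variable {E : Type*} [NormedAddCommGroup E] [NormedSpace ℝ E]

/-- The partial derivative `∂g/∂x` of a function `g(x, y)` on the plane. -/
def partialFst (g : ℝ × ℝ → E) (p : ℝ × ℝ) : E := fderiv ℝ g p (1, 0)

/-- The partial derivative `∂g/∂y` of a function `g(x, y)` on the plane. -/
def partialSnd (g : ℝ × ℝ → E) (p : ℝ × ℝ) : E := fderiv ℝ g p (0, 1)

variable {g : ℝ × ℝ → E} {x y : ℝ}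

lemma hasDerivAt_partialFst (hg : DifferentiableAt ℝ g (x, y)) :
    HasDerivAt (fun x => g (x, y)) (partialFst g (x, y)) x :=
  hg.hasFDerivAt.comp_hasDerivAt x ((hasDerivAt_id x).prodMk (hasDerivAt_const x y))

lemma hasDerivAt_partialSnd (hg : DifferentiableAt ℝ g (x, y)) :
    HasDerivAt (fun y => g (x, y)) (partialSnd g (x, y)) y :=
  hg.hasFDerivAt.comp_hasDerivAt y ((hasDerivAt_const y x).prodMk (hasDerivAt_id y))

lemma hasFDerivAt_fderiv_apply {p : ℝ × ℝ} (hg : ContDiffAt ℝ 2 g p) (e : ℝ × ℝ) :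
    HasFDerivAt (fun q => fderiv ℝ g q e)
      ((ContinuousLinearMap.apply ℝ E e).comp (fderiv ℝ (fderiv ℝ g) p)) p :=
  (ContinuousLinearMap.apply ℝ E e).hasFDerivAt.comp p
    ((hg.fderiv_right (m := 1) (by norm_num)).differentiableAt one_ne_zero).hasFDerivAt

lemma partialFst_partialSnd {p : ℝ × ℝ} (hg : ContDiffAt ℝ 2 g p) :
    partialFst (partialSnd g) p = partialSnd (partialFst g) p := by
  have hsymm := hg.isSymmSndFDerivAt (by simp) (1, 0) (0, 1)
  unfold partialFst partialSnd
  rw [(hasFDerivAt_fderiv_apply hg (0, 1)).fderiv, (hasFDerivAt_fderiv_apply hg (1, 0)).fderiv]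
  simpa using hsymm

lemma hasDerivAt_partialSnd_partialFst (hg : ContDiffAt ℝ 2 g (x, y)) :
    HasDerivAt (fun y => partialFst g (x, y)) (partialSnd (partialFst g) (x, y)) y :=
  hasDerivAt_partialSnd (hasFDerivAt_fderiv_apply hg (1, 0)).differentiableAt

lemma hasDerivAt_partialFst_partialSnd (hg : ContDiffAt ℝ 2 g (x, y)) :
    HasDerivAt (fun x => partialSnd g (x, y)) (partialSnd (partialFst g) (x, y)) x := by
  rw [← partialFst_partialSnd hg]
  exact hasDerivAt_partialFst (hasFDerivAt_fderiv_apply hg (0, 1)).differentiableAt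

end PlaneDerivatives

section LinearEquation

variable {U X : Type*} [NormedAddCommGroup U] [NormedSpace ℝ U]
  [NormedAddCommGroup X] [NormedSpace ℝ X]

lemma isUnit_one_sub_of_isCompactOperator [CompleteSpace X] {T : X →L[ℝ] X}
    (hT : IsCompactOperator T) (hinj : ∀ k, k = T k → k = 0) : IsUnit (1 - T) := by
  rcases hT.hasEigenvalue_or_mem_resolventSet (one_ne_zero (α := ℝ)) with h | h
  · obtain ⟨k, hk⟩ := h.exists_hasEigenvector
    exact absurd (hinj k (by simpa using hk.apply_eq_smul.symm)) hk.2
  · simpa [spectrum.mem_resolventSet_iff] using h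

lemma eq_inverse_apply_of_eq_add_apply {T : X →L[ℝ] X} (hT : IsUnit (1 - T)) {g k : X}
    (hk : k = g + T k) : k = Ring.inverse (1 - T) g := by
  have hg : g = (1 - T) k := by
    rw [sub_apply, one_apply_eq_self, eq_sub_iff_add_eq]
    exact hk.symm
  rw [hg, ← mul_apply_eq_comp, Ring.inverse_mul_cancel _ hT, one_apply_eq_self]

lemma differentiableAt_of_eq_add_clm_apply [CompleteSpace X] {A : U → X →L[ℝ] X}
    {g k : U → X} {u : U} (hA : DifferentiableAt ℝ A u)
    (hg : DifferentiableAt ℝ g u) (hu : IsUnit (1 - A u))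
    (hk : ∀ᶠ w in 𝓝 u, k w = g w + A w (k w)) : DifferentiableAt ℝ k u := by
  have hinv : DifferentiableAt ℝ (fun w => Ring.inverse (1 - A w)) u :=
    DifferentiableAt.comp (g := Ring.inverse) (f := fun w => 1 - A w) u
      (differentiableAt_inverse (𝕜 := ℝ) hu) ((differentiableAt_const _).sub hA)
  have hunit : ∀ᶠ w in 𝓝 u, IsUnit (1 - A w) :=
    (continuousAt_const.sub hA.continuousAt).eventually (Units.isOpen.mem_nhds hu)
  refine (hinv.clm_apply hg).congr_of_eventuallyEq ?_
  filter_upwards [hunit, hk] with w hw hkw using eq_inverse_apply_of_eq_add_apply hw hkw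

lemma fderiv_apply_of_eq_add_clm_apply {A : U → X →L[ℝ] X} {g k : U → X} {u : U}
    {A' : U →L[ℝ] X →L[ℝ] X} {g' : U →L[ℝ] X}
    (hA : HasFDerivAt A A' u) (hg : HasFDerivAt g g' u) (hk' : DifferentiableAt ℝ k u)
    (hk : ∀ᶠ w in 𝓝 u, k w = g w + A w (k w)) (v : U) :
    fderiv ℝ k u v = g' v + A' v (k u) + A u (fderiv ℝ k u v) := by
  have hsum := (hg.add (hA.clm_apply hk'.hasFDerivAt)).congr_of_eventuallyEq hk
  refine (DFunLike.congr_fun hsum.fderiv v).trans ?_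
  simp only [add_apply, ContinuousLinearMap.comp_apply, ContinuousLinearMap.flip_apply]
  abel

end LinearEquation

section IntegralOperator

set_option maxSynthPendingDepth 3

variable {α E X : Type*} [TopologicalSpace α] [MeasurableSpace α]
  [NormedAddCommGroup E] [NormedSpace ℝ E]
  [NormedAddCommGroup X] [NormedSpace ℝ X] {μ : Measure α} {Φ Ψ : α → E →L[ℝ] X}

lemma norm_integral_clm_apply_bounded_le (hΦ : Integrable Φ μ)
    (k : BoundedContinuousFunction α E) :
    ‖∫ q, Φ q (k q) ∂μ‖ ≤ (∫ q, ‖Φ q‖ ∂μ) * ‖k‖ := by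
  rw [← integral_mul_const]
  exact norm_integral_le_of_norm_le (hΦ.norm.mul_const ‖k‖)
    (Eventually.of_forall fun q => (Φ q).le_opNorm_of_le (k.norm_coe_le_norm q))

variable [OpensMeasurableSpace α] [SecondCountableTopologyEither α E]

lemma integrable_clm_apply_bounded (hΦ : Integrable Φ μ) (k : BoundedContinuousFunction α E) :
    Integrable (fun q => Φ q (k q)) μ := by
  refine (hΦ.norm.mul_const ‖k‖).mono'
    (isBoundedBilinearMap_apply.continuous.comp_aestronglyMeasurable
      (hΦ.aestronglyMeasurable.prodMk k.continuous.aestronglyMeasurable)) ?_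
  exact Eventually.of_forall fun q => (Φ q).le_opNorm_of_le (k.norm_coe_le_norm q)

open Classical in
/-- The operator `k ↦ ∫ Φ(q) k(q) dμ(q)` on bounded continuous functions, for an integrable
operator-valued function `Φ`; it is `0` when `Φ` is not integrable. -/
def integralOp (μ : Measure α) (Φ : α → E →L[ℝ] X) : BoundedContinuousFunction α E →L[ℝ] X :=
  if hΦ : Integrable Φ μ then
    LinearMap.mkContinuous
      { toFun := fun k => ∫ q, Φ q (k q) ∂μ
        map_add' := fun k k' => by
          rw [← integral_add (integrable_clm_apply_bounded hΦ k)
            (integrable_clm_apply_bounded hΦ k')]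
          simp only [BoundedContinuousFunction.add_apply, map_add]
        map_smul' := fun c k => by
          rw [RingHom.id_apply, ← integral_smul]
          simp only [BoundedContinuousFunction.smul_apply, map_smul] }
      (∫ q, ‖Φ q‖ ∂μ) (norm_integral_clm_apply_bounded_le hΦ)
  else 0

lemma integralOp_apply (hΦ : Integrable Φ μ) (k : BoundedContinuousFunction α E) :
    integralOp μ Φ k = ∫ q, Φ q (k q) ∂μ := by
  rw [integralOp, dif_pos hΦ]; rfl

lemma norm_integralOp_le (hΦ : Integrable Φ μ) : ‖integralOp μ Φ‖ ≤ ∫ q, ‖Φ q‖ ∂μ :=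
  ContinuousLinearMap.opNorm_le_bound _ (integral_nonneg fun _ => norm_nonneg _) fun k =>
    (congrArg norm (integralOp_apply hΦ k)).trans_le (norm_integral_clm_apply_bounded_le hΦ k)

lemma integralOp_add (hΦ : Integrable Φ μ) (hΨ : Integrable Ψ μ) :
    integralOp μ (Φ + Ψ) = integralOp μ Φ + integralOp μ Ψ := by
  ext1 k
  rw [add_apply, integralOp_apply (hΦ.add hΨ), integralOp_apply hΦ, integralOp_apply hΨ,
    ← integral_add (integrable_clm_apply_bounded hΦ k) (integrable_clm_apply_bounded hΨ k)]
  rfl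

lemma integralOp_smul (hΦ : Integrable Φ μ) (c : ℝ) :
    integralOp μ (c • Φ) = c • integralOp μ Φ := by
  ext1 k
  rw [smul_apply, integralOp_apply (hΦ.smul c), integralOp_apply hΦ, ← integral_smul]
  rfl

lemma integralOp_sub (hΦ : Integrable Φ μ) (hΨ : Integrable Ψ μ) :
    integralOp μ (Φ - Ψ) = integralOp μ Φ - integralOp μ Ψ := by
  ext1 k
  rw [sub_apply, integralOp_apply (hΦ.sub hΨ), integralOp_apply hΦ, integralOp_apply hΨ,
    ← integral_sub (integrable_clm_apply_bounded hΦ k) (integrable_clm_apply_bounded hΨ k)]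
  rfl

lemma integralOp_congr_ae (h : Φ =ᵐ[μ] Ψ) : integralOp μ Φ = integralOp μ Ψ := by
  by_cases hΦ : Integrable Φ μ
  · ext1 k
    rw [integralOp_apply hΦ, integralOp_apply (hΦ.congr h)]
    exact integral_congr_ae (h.mono fun q hq => by simp only [hq])
  · have hΨ : ¬ Integrable Ψ μ := fun hΨ => hΦ (hΨ.congr h.symm)
    rw [integralOp, integralOp, dif_neg hΦ, dif_neg hΨ]

lemma lipschitzWith_integralOp : LipschitzWith 1 fun Φ : α →₁[μ] (E →L[ℝ] X) => integralOp μ Φ := by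
  refine LipschitzWith.of_dist_le_mul fun Φ Ψ => ?_
  have hΦ := L1.integrable_coeFn Φ
  have hΨ := L1.integrable_coeFn Ψ
  rw [dist_eq_norm, dist_eq_norm, ← integralOp_sub hΦ hΨ, NNReal.coe_one, one_mul,
    L1.norm_eq_integral_norm]
  refine (norm_integralOp_le (hΦ.sub hΨ)).trans_eq ?_
  exact integral_congr_ae ((Lp.coeFn_sub Φ Ψ).mono fun q hq => congrArg norm hq.symm)

lemma isCompactOperator_integralOp_indicator_const [FiniteDimensional ℝ E] [CompleteSpace X]
    (T : E →L[ℝ] X) {S : Set α} (hS : MeasurableSet S) (hfin : μ S ≠ ⊤) :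
    IsCompactOperator (integralOp μ (S.indicator fun _ => T)) := by
  have : ProperSpace E := FiniteDimensional.proper_real E
  have hT : Integrable (S.indicator fun _ => T) μ :=
    (integrable_indicator_iff hS).2 (integrableOn_const (C := T) hfin)
  have hid : Integrable (S.indicator fun _ => ContinuousLinearMap.id ℝ E) μ :=
    (integrable_indicator_iff hS).2 (integrableOn_const (C := ContinuousLinearMap.id ℝ E) hfin)
  have hcomp : integralOp μ (S.indicator fun _ => T)
      = T.comp (integralOp μ (S.indicator fun _ => ContinuousLinearMap.id ℝ E)) := by
    ext1 k
    rw [integralOp_apply hT, ContinuousLinearMap.comp_apply, integralOp_apply hid,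
      ← ContinuousLinearMap.integral_comp_comm _ (integrable_clm_apply_bounded hid k)]
    refine integral_congr_ae (Eventually.of_forall fun q => ?_)
    by_cases hq : q ∈ S <;> simp [hq]
  rw [hcomp]
  exact (isCompactOperator_of_locallyCompactSpace_dom
    (integralOp μ (S.indicator fun _ => ContinuousLinearMap.id ℝ E))).clm_comp T

lemma isCompactOperator_integralOp [FiniteDimensional ℝ E] [CompleteSpace X]
    (hΦ : Integrable Φ μ) : IsCompactOperator (integralOp μ Φ) := by
  have hcont : Continuous fun Φ : α →₁[μ] (E →L[ℝ] X) => integralOp μ Φ :=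
    lipschitzWith_integralOp.continuous
  refine Integrable.induction (fun Φ => IsCompactOperator (integralOp μ Φ))
    (fun T S hS hfin => isCompactOperator_integralOp_indicator_const T hS hfin.ne)
    (fun Φ Ψ _ hΦ hΨ hΦc hΨc => ?_)
    (isClosed_setOfPred_isCompactOperator.preimage hcont) (fun Φ Ψ h _ hc => ?_) hΦ
  · rw [integralOp_add hΦ hΨ]
    exact hΦc.add hΨc
  · rwa [← integralOp_congr_ae h]

lemma hasFDerivAt_integralOp {U : Type*} [NormedAddCommGroup U] [NormedSpace ℝ U]
    {Φ Φ' : U → α → E →L[ℝ] X}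
    {A' : U →L[ℝ] BoundedContinuousFunction α E →L[ℝ] X}
    {u : U} {b : α → ℝ} (hΦ : ∀ᶠ w in 𝓝 u, Integrable (Φ w) μ) (hΦ' : ∀ v, Integrable (Φ' v) μ)
    (hA' : ∀ v, A' v = integralOp μ (Φ' v)) (hb : Integrable b μ)
    (h : ∀ᶠ w in 𝓝 u, ∀ᵐ q ∂μ, ‖Φ w q - Φ u q - Φ' (w - u) q‖ ≤ b q * ‖w - u‖ ^ 2) :
    HasFDerivAt (fun w => integralOp μ (Φ w)) A' u := by
  refine hasFDerivAt_of_eventually_norm_sub_le_sq (C := ∫ q, b q ∂μ) ?_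
  filter_upwards [hΦ, h] with w hw hbound
  have hsub := (hw.sub hΦ.self_of_nhds).sub (hΦ' (w - u))
  rw [hA', ← integralOp_sub hw hΦ.self_of_nhds,
    ← integralOp_sub (hw.sub hΦ.self_of_nhds) (hΦ' _), ← integral_mul_const]
  exact (norm_integralOp_le hsub).trans (integral_mono_ae hsub.norm (hb.mul_const _) hbound)

end IntegralOperator

section Bounded

variable {X V : Type*} [TopologicalSpace X] [NormedAddCommGroup V]

open Classical in
/-- The bounded continuous function with the given values; it is `0` when the given function is not
bounded and continuous. -/
def toBounded (g : X → V) : BoundedContinuousFunction X V :=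
  if h : Continuous g ∧ ∃ C, ∀ x, ‖g x‖ ≤ C then
    BoundedContinuousFunction.ofNormedAddCommGroup g h.1 h.2.choose h.2.choose_spec
  else 0

lemma toBounded_apply {g : X → V} (hg : Continuous g) {C : ℝ} (hC : ∀ x, ‖g x‖ ≤ C) (x : X) :
    toBounded g x = g x := by
  rw [toBounded, dif_pos ⟨hg, C, hC⟩]; rfl

end Bounded

/-- A function dominating the decay of a kernel in one of its variables on `[t, ∞)`. -/
structure IsDecayBound (t : ℝ) (m : ℝ → ℝ) : Prop where
  antitoneOn : AntitoneOn m (Ici t)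
  integrableOn : IntegrableOn m (Ici t)

namespace IsDecayBound

variable {s t : ℝ} {m : ℝ → ℝ}

lemma nonneg (h : IsDecayBound t m) {x : ℝ} (hx : t ≤ x) : 0 ≤ m x := by
  by_contra! hneg
  have hconst : IntegrableOn (fun _ : ℝ => m x) (Ioi x) := by
    refine (h.integrableOn.mono_set fun y hy => hx.trans (le_of_lt hy)).integrable.mono
      aestronglyMeasurable_const
      ((ae_restrict_iff' measurableSet_Ioi).2 (.of_forall fun y hy => ?_))
    have hy' : m y ≤ m x := h.antitoneOn hx (hx.trans (le_of_lt hy)) (le_of_lt hy)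
    rw [Real.norm_of_nonpos hneg.le, Real.norm_of_nonpos (hy'.trans hneg.le)]
    exact neg_le_neg hy'
  simp [integrableOn_const_iff, hneg.ne] at hconst

lemma mono (h : IsDecayBound t m) (hts : t ≤ s) : IsDecayBound s m where
  antitoneOn := h.antitoneOn.mono (Ici_subset_Ici.2 hts)
  integrableOn := h.integrableOn.mono_set (Ici_subset_Ici.2 hts)

lemma const_mul (h : IsDecayBound t m) {c : ℝ} (hc : 0 ≤ c) :
    IsDecayBound t fun x => c * m x where
  antitoneOn _ hx _ hy hxy := mul_le_mul_of_nonneg_left (h.antitoneOn hx hy hxy) hc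
  integrableOn := h.integrableOn.const_mul c

lemma comp_sub_const (h : IsDecayBound t m) (a : ℝ) : IsDecayBound (t + a) fun x => m (x - a) where
  antitoneOn x hx y hy hxy := h.antitoneOn (mem_Ici.2 (le_sub_iff_add_le.2 hx))
    (mem_Ici.2 (le_sub_iff_add_le.2 hy)) (sub_le_sub_right hxy a)
  integrableOn := by
    have := (measurePreserving_sub_right (volume : Measure ℝ) a).integrableOn_comp_preimage
      (measurableEmbedding_subRight a) (f := m) (s := Ici t)
    refine (this.2 h.integrableOn).mono_set fun q hq => ?_
    exact mem_Ici.2 (le_sub_iff_add_le.2 (mem_Ici.1 hq))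

lemma le_apply (h : IsDecayBound t m) {x y : ℝ} (hx : t ≤ x) (hxy : x ≤ y) : m y ≤ m x :=
  h.antitoneOn hx (hx.trans hxy) hxy

end IsDecayBound

/-- A matrix kernel `H_ij(x, y)`, of class `Cⁿ` at the points of the quadrant `x ≥ t`, `y ≥ t`,
whose derivatives of order at most `n` are bounded there by `M(x) B(y)`. -/
structure DecayingKernel {ι : Type*} (n : ℕ) (t : ℝ) (H : ι → ι → ℝ × ℝ → ℂ) (M B : ℝ → ℝ) :
    Prop where
  left : IsDecayBound t M
  right : IsDecayBound t B
  contDiffAt : ∀ i j, ∀ x ≥ t, ∀ y ≥ t, ContDiffAt ℝ n (H i j) (x, y)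
  norm_iteratedFDeriv_le : ∀ i j, ∀ k ≤ n, ∀ x ≥ t, ∀ y ≥ t,
    ‖iteratedFDeriv ℝ k (H i j) (x, y)‖ ≤ M x * B y

section Kernel

variable {ι : Type*} {n : ℕ} {s t : ℝ} {H : ι → ι → ℝ × ℝ → ℂ} {M B : ℝ → ℝ}

/-- The derivative of the entry `H_ij` in the direction `e_ij`, for all entries. -/
def dirDeriv (H : ι → ι → ℝ × ℝ → ℂ) (e : ι → ι → ℝ × ℝ) (i j : ι) (p : ℝ × ℝ) : ℂ :=
  fderiv ℝ (H i j) p (e i j)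

/-- The kernel `H_ij(x - uⁱ, y - uʲ)`. -/
def shiftedKernel (H : ι → ι → ℝ × ℝ → ℂ) (u : ι → ℝ) (i j : ι) (p : ℝ × ℝ) : ℂ :=
  H i j (p - (u i, u j))

/-- The derivative at `w = 0` of `w ↦ shiftedKernel H w` in the direction `v`. -/
def shiftDeriv (H : ι → ι → ℝ × ℝ → ℂ) (v : ι → ℝ) : ι → ι → ℝ × ℝ → ℂ :=
  dirDeriv H fun i j => -(v i, v j)

lemma shiftedKernel_eq_shiftedKernel_comp_sub (u w : ι → ℝ) (i j : ι) :
    shiftedKernel H w i j = fun p => shiftedKernel H u i j (p - (w i - u i, w j - u j)) := by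
  ext p
  simp only [shiftedKernel, sub_sub, Prod.mk_add_mk, sub_add_cancel]

lemma le_sub_sub_of_norm_sub_le [Fintype ι] {u w : ι → ℝ} (hw : ‖w - u‖ ≤ s - t) (i : ι) (x : ℝ) :
    x - (s - t) ≤ x - (w i - u i) :=
  sub_le_sub_left ((le_abs_self _).trans ((norm_le_pi_norm (w - u) i).trans hw)) x

lemma shiftDeriv_add (v w : ι → ℝ) (i j : ι) (p : ℝ × ℝ) :
    shiftDeriv H (v + w) i j p = shiftDeriv H v i j p + shiftDeriv H w i j p := by
  rw [shiftDeriv, shiftDeriv, shiftDeriv, dirDeriv, dirDeriv, dirDeriv, ← map_add]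
  congr 1
  ext <;> simp <;> ring

lemma shiftDeriv_smul (c : ℝ) (v : ι → ℝ) (i j : ι) (p : ℝ × ℝ) :
    shiftDeriv H (c • v) i j p = c • shiftDeriv H v i j p := by
  rw [shiftDeriv, shiftDeriv, dirDeriv, dirDeriv, ← map_smul]
  congr 1
  ext <;> simp

namespace DecayingKernel

lemma mono (h : DecayingKernel n t H M B) (hts : t ≤ s) : DecayingKernel n s H M B where
  left := h.left.mono hts
  right := h.right.mono hts
  contDiffAt i j x hx y hy := h.contDiffAt i j x (hts.trans hx) y (hts.trans hy)
  norm_iteratedFDeriv_le i j k hk x hx y hy :=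
    h.norm_iteratedFDeriv_le i j k hk x (hts.trans hx) y (hts.trans hy)

lemma of_le {n' : ℕ} (h : DecayingKernel n t H M B) (hn : n' ≤ n) : DecayingKernel n' t H M B where
  left := h.left
  right := h.right
  contDiffAt i j x hx y hy := (h.contDiffAt i j x hx y hy).of_le (by exact_mod_cast hn)
  norm_iteratedFDeriv_le i j k hk := h.norm_iteratedFDeriv_le i j k (hk.trans hn)

lemma bound_nonneg (h : DecayingKernel n t H M B) {x y : ℝ} (hx : t ≤ x) (hy : t ≤ y) :
    0 ≤ M x * B y :=
  mul_nonneg (h.left.nonneg hx) (h.right.nonneg hy)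

lemma bound_le_bound (h : DecayingKernel n t H M B) {x x' y y' : ℝ}
    (hx : t ≤ x) (hxx' : x ≤ x') (hy : t ≤ y) (hyy' : y ≤ y') : M x' * B y' ≤ M x * B y :=
  mul_le_mul (h.left.le_apply hx hxx') (h.right.le_apply hy hyy')
    (h.right.nonneg (hy.trans hyy')) (h.left.nonneg hx)

lemma norm_le (h : DecayingKernel n t H M B) (i j : ι) {x y : ℝ} (hx : t ≤ x) (hy : t ≤ y) :
    ‖H i j (x, y)‖ ≤ M x * B y := by
  simpa using h.norm_iteratedFDeriv_le i j 0 n.zero_le x hx y hy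

lemma differentiableAt (h : DecayingKernel (n + 1) t H M B) (i j : ι) {x y : ℝ} (hx : t ≤ x)
    (hy : t ≤ y) : DifferentiableAt ℝ (H i j) (x, y) :=
  (h.contDiffAt i j x hx y hy).differentiableAt (by exact_mod_cast n.succ_ne_zero)

lemma norm_fderiv_le (h : DecayingKernel (n + 1) t H M B) (i j : ι) {x y : ℝ} (hx : t ≤ x)
    (hy : t ≤ y) : ‖fderiv ℝ (H i j) (x, y)‖ ≤ M x * B y := by
  simpa [norm_iteratedFDeriv_one] using h.norm_iteratedFDeriv_le i j 1 (by omega) x hx y hy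

lemma norm_fderiv_fderiv_le (h : DecayingKernel 2 t H M B) (i j : ι) {x y : ℝ} (hx : t ≤ x)
    (hy : t ≤ y) : ‖fderiv ℝ (fderiv ℝ (H i j)) (x, y)‖ ≤ M x * B y := by
  have := h.norm_iteratedFDeriv_le i j (1 + 1) le_rfl x hx y hy
  rwa [← norm_iteratedFDeriv_fderiv, norm_iteratedFDeriv_one] at this

protected lemma dirDeriv (h : DecayingKernel (n + 1) t H M B) {e : ι → ι → ℝ × ℝ} {c : ℝ}
    (hc : 0 ≤ c) (he : ∀ i j, ‖e i j‖ ≤ c) :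
    DecayingKernel n t (dirDeriv H e) (fun x => c * M x) B where
  left := h.left.const_mul hc
  right := h.right
  contDiffAt i j x hx y hy :=
    ((h.contDiffAt i j x hx y hy).fderiv_right (m := n) (by norm_cast)).clm_apply contDiffAt_const
  norm_iteratedFDeriv_le i j k hk x hx y hy := by
    have hderiv : ContDiffAt ℝ k (fderiv ℝ (H i j)) (x, y) :=
      (h.contDiffAt i j x hx y hy).fderiv_right (by norm_cast; omega)
    calc ‖iteratedFDeriv ℝ k (fun p => fderiv ℝ (H i j) p (e i j)) (x, y)‖
        ≤ ‖e i j‖ * ‖iteratedFDeriv ℝ (k + 1) (H i j) (x, y)‖ := by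
          rw [← norm_iteratedFDeriv_fderiv]
          exact norm_iteratedFDeriv_clm_apply_const hderiv le_rfl
      _ ≤ c * (M x * B y) :=
          mul_le_mul (he i j) (h.norm_iteratedFDeriv_le i j (k + 1) (by omega) x hx y hy)
            (norm_nonneg _) hc
      _ = c * M x * B y := (mul_assoc _ _ _).symm

lemma norm_apply_sub_apply_le (h : DecayingKernel (n + 1) t H M B) (i j : ι) {x x' y : ℝ}
    (hx : t ≤ x) (hx' : t ≤ x') (hy : t ≤ y) :
    ‖H i j (x', y) - H i j (x, y)‖ ≤ M t * B t * ‖x' - x‖ := by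
  refine (convex_Ici t).norm_image_sub_le_of_norm_hasDerivWithin_le (f := fun x => H i j (x, y))
    (fun z hz => (hasDerivAt_partialFst (h.differentiableAt i j hz hy)).hasDerivWithinAt)
    (fun z hz => ?_) hx hx'
  refine ((fderiv ℝ (H i j) (z, y)).le_opNorm _).trans ?_
  refine (mul_le_of_le_one_right (norm_nonneg _) (by simp [Prod.norm_def])).trans ?_
  exact (h.norm_fderiv_le i j hz hy).trans (h.bound_le_bound le_rfl hz le_rfl hy)

protected lemma shiftedKernel [Fintype ι] {u w : ι → ℝ}
    (h : DecayingKernel n t (shiftedKernel H u) M B) (hw : ‖w - u‖ ≤ s - t) :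
    DecayingKernel n s (shiftedKernel H w) (fun x => M (x - (s - t)))
      (fun y => B (y - (s - t))) where
  left := by simpa using h.left.comp_sub_const (s - t)
  right := by simpa using h.right.comp_sub_const (s - t)
  contDiffAt i j x hx y hy := by
    have hx' := le_sub_sub_of_norm_sub_le hw i x
    have hy' := le_sub_sub_of_norm_sub_le hw j y
    rw [shiftedKernel_eq_shiftedKernel_comp_sub u w]
    have hH := h.contDiffAt i j (x - (w i - u i)) (by linarith) (y - (w j - u j)) (by linarith)
    exact ContDiffAt.comp (g := shiftedKernel H u i j) (x, y) hH
      (contDiffAt_id.sub contDiffAt_const)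
  norm_iteratedFDeriv_le i j k hk x hx y hy := by
    have hx' := le_sub_sub_of_norm_sub_le hw i x
    have hy' := le_sub_sub_of_norm_sub_le hw j y
    rw [shiftedKernel_eq_shiftedKernel_comp_sub u w, iteratedFDeriv_comp_sub]
    exact (h.norm_iteratedFDeriv_le i j k hk _ (by linarith) _ (by linarith)).trans
      (h.bound_le_bound (by linarith) hx' (by linarith) hy')

lemma norm_shiftedKernel_sub_sub_le [Fintype ι] {u w : ι → ℝ}
    (h : DecayingKernel 2 t (shiftedKernel H u) M B) (hw : ‖w - u‖ ≤ s - t) (i j : ι)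
    {x y : ℝ} (hx : s ≤ x) (hy : s ≤ y) :
    ‖shiftedKernel H w i j (x, y) - shiftedKernel H u i j (x, y)
      - shiftDeriv (shiftedKernel H u) (w - u) i j (x, y)‖
      ≤ M (x - (s - t)) * B t * ‖w - u‖ ^ 2 := by
  have hts : 0 ≤ s - t := (norm_nonneg _).trans hw
  have hx' := le_sub_sub_of_norm_sub_le hw i x
  have hy' := le_sub_sub_of_norm_sub_le hw j y
  have htaylor := norm_sub_sub_fderiv_le_of_norm_fderiv_fderiv_le
    ((convex_Ici (x - (s - t))).prod (convex_Ici t)) (C := M (x - (s - t)) * B t)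
    (fun p hp => h.contDiffAt i j p.1 (le_trans (by linarith) hp.1) p.2 hp.2)
    (fun p hp => (h.norm_fderiv_fderiv_le i j (le_trans (by linarith) hp.1) hp.2).trans
      (h.bound_le_bound (by linarith) hp.1 le_rfl hp.2))
    (x := (x, y)) (y := (x, y) - (w i - u i, w j - u j))
    ⟨mem_Ici.2 (by linarith), mem_Ici.2 (by linarith)⟩
    ⟨mem_Ici.2 (by simpa using hx'), mem_Ici.2 (by simp; linarith)⟩
  have hshift : ‖((w i - u i, w j - u j) : ℝ × ℝ)‖ ≤ ‖w - u‖ :=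
    max_le (norm_le_pi_norm (w - u) i) (norm_le_pi_norm (w - u) j)
  rw [sub_sub_cancel_left, norm_neg] at htaylor
  rw [shiftedKernel_eq_shiftedKernel_comp_sub u w]
  refine htaylor.trans (mul_le_mul_of_nonneg_left (by gcongr) ?_)
  exact h.bound_nonneg (by linarith) le_rfl

protected lemma partialFst (h : DecayingKernel (n + 1) t H M B) :
    DecayingKernel n t (fun l j => partialFst (H l j)) M B := by
  have := h.dirDeriv (e := fun _ _ => (1, 0)) zero_le_one (by simp [Prod.norm_def])
  simp only [one_mul] at this
  exact this

protected lemma partialSnd (h : DecayingKernel (n + 1) t H M B) :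
    DecayingKernel n t (fun l j => partialSnd (H l j)) M B := by
  have := h.dirDeriv (e := fun _ _ => (0, 1)) zero_le_one (by simp [Prod.norm_def])
  simp only [one_mul] at this
  exact this

end DecayingKernel

end Kernel

section KernelOperator

set_option maxSynthPendingDepth 3

variable {ι : Type*} [Fintype ι] {n : ℕ} {s t x : ℝ} {H : ι → ι → ℝ × ℝ → ℂ} {M B : ℝ → ℝ}

/-- The space of the rows `s' ↦ (k_j(s'))_j` of a solution. A row on `[s, ∞)` is extended to the
line by its value at `s`, so that the space does not depend on `s`. -/
abbrev RowSpace (ι : Type*) [Fintype ι] : Type _ := BoundedContinuousFunction ℝ (ι → ℂ)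

/-- The row `s' ↦ (H_lj(x, s'))_j`, `s' ≥ s`. -/
def kernelRow (H : ι → ι → ℝ × ℝ → ℂ) (s x : ℝ) (l : ι) : RowSpace ι :=
  toBounded fun y j => H l j (x, max y s)

/-- The map `c ↦ ∑_l c_l H_l·(x, ·)`, multiplication of a row vector by the kernel. -/
def kernelMap (H : ι → ι → ℝ × ℝ → ℂ) (s x : ℝ) : (ι → ℂ) →L[ℝ] RowSpace ι :=
  ∑ l, ((ContinuousLinearMap.proj l : (ι → ℂ) →L[ℂ] ℂ).smulRight
    (kernelRow H s x l)).restrictScalars ℝ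

/-- The operator `k ↦ ∫_s^∞ k(q) H(q, ·) dq` on rows. -/
def kernelOp (H : ι → ι → ℝ × ℝ → ℂ) (s : ℝ) : RowSpace ι →L[ℝ] RowSpace ι :=
  integralOp (volume.restrict (Ioi s)) (kernelMap H s)

lemma norm_le_of_apply_eq_sum_mul {T : (ι → ℂ) →L[ℝ] RowSpace ι} {a : ι → ι → ℝ → ℂ} {C : ℝ}
    (hC : 0 ≤ C) (hT : ∀ c y j, T c y j = ∑ l, c l * a l j y) (ha : ∀ l j y, ‖a l j y‖ ≤ C) :
    ‖T‖ ≤ Fintype.card ι * C := by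
  refine T.opNorm_le_bound (by positivity) fun c => ?_
  refine (BoundedContinuousFunction.norm_le (by positivity)).2 fun y => ?_
  refine (pi_norm_le_iff_of_nonneg (by positivity)).2 fun j => ?_
  calc ‖T c y j‖ ≤ ∑ l, ‖c l * a l j y‖ := by rw [hT]; exact norm_sum_le _ _
    _ ≤ ∑ _l : ι, ‖c‖ * C := Finset.sum_le_sum fun l _ => by
        rw [norm_mul]
        exact mul_le_mul (norm_le_pi_norm c l) (ha l j y) (norm_nonneg _) (norm_nonneg _)
    _ = Fintype.card ι * C * ‖c‖ := by simp [mul_comm C, mul_assoc]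

lemma kernelRow_apply (h : DecayingKernel n s H M B) (hx : s ≤ x) (l : ι) (y : ℝ) (j : ι) :
    kernelRow H s x l y j = H l j (x, max y s) := by
  have hcont : Continuous fun y j => H l j (x, max y s) := by
    refine continuous_pi fun j => continuous_iff_continuousAt.2 fun y => ?_
    exact ContinuousAt.comp (g := H l j) (h.contDiffAt l j x hx _ (le_max_right y s)).continuousAt
      (by fun_prop)
  have hbound : ∀ y, ‖fun j => H l j (x, max y s)‖ ≤ M x * B s := fun y =>
    (pi_norm_le_iff_of_nonneg (h.bound_nonneg hx le_rfl)).2 fun j =>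
      (h.norm_le l j hx (le_max_right y s)).trans
        (h.bound_le_bound hx le_rfl le_rfl (le_max_right y s))
  rw [kernelRow, toBounded_apply hcont hbound]

lemma kernelMap_apply (h : DecayingKernel n s H M B) (hx : s ≤ x) (c : ι → ℂ) (y : ℝ) (j : ι) :
    kernelMap H s x c y j = ∑ l, c l * H l j (x, max y s) := by
  simp [kernelMap, kernelRow_apply h hx, BoundedContinuousFunction.coe_sum]

lemma norm_kernelMap_le (h : DecayingKernel n s H M B) (hx : s ≤ x) :
    ‖kernelMap H s x‖ ≤ Fintype.card ι * (M x * B s) :=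
  norm_le_of_apply_eq_sum_mul (h.bound_nonneg hx le_rfl) (kernelMap_apply h hx) fun l j y =>
    (h.norm_le l j hx (le_max_right y s)).trans
      (h.bound_le_bound hx le_rfl le_rfl (le_max_right y s))

lemma continuousOn_kernelMap (h : DecayingKernel (n + 1) s H M B) :
    ContinuousOn (kernelMap H s) (Ici s) := by
  have hnonneg := h.bound_nonneg le_rfl le_rfl
  refine (LipschitzOnWith.of_dist_le_mul (f := kernelMap H s)
    (K := (Fintype.card ι * (M s * B s)).toNNReal) fun x hx x' hx' => ?_).continuousOn
  rw [Real.coe_toNNReal _ (by positivity), dist_eq_norm, dist_eq_norm, mul_assoc]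
  refine norm_le_of_apply_eq_sum_mul (by positivity) (a := fun l j y =>
    H l j (x, max y s) - H l j (x', max y s)) (fun c y j => ?_)
    fun l j y => h.norm_apply_sub_apply_le l j hx' hx (le_max_right y s)
  simp [kernelMap_apply h hx, kernelMap_apply h hx', mul_sub, Finset.sum_sub_distrib]

lemma integrableOn_kernelMap (h : DecayingKernel (n + 1) s H M B) :
    IntegrableOn (kernelMap H s) (Ioi s) := by
  have : SecondCountableTopologyEither ℝ ((ι → ℂ) →L[ℝ] RowSpace ι) :=
    secondCountableTopologyEither_of_left ℝ _
  refine Integrable.mono' (g := fun x => Fintype.card ι * (M x * B s))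
    (((h.left.integrableOn.mono_set Ioi_subset_Ici_self).mul_const _).const_mul _)
    (((continuousOn_kernelMap h).mono Ioi_subset_Ici_self).aestronglyMeasurable measurableSet_Ioi)
    ?_
  exact (ae_restrict_iff' measurableSet_Ioi).2
    (.of_forall fun x hx => norm_kernelMap_le h (le_of_lt hx))

lemma kernelOp_apply (h : DecayingKernel (n + 1) s H M B) (k : RowSpace ι) (y : ℝ) (j : ι) :
    kernelOp H s k y j = ∫ q in Ioi s, ∑ l, k q l * H l j (q, max y s) := by
  let eval : RowSpace ι →L[ℝ] ℂ :=
    (ContinuousLinearMap.proj (R := ℝ) (φ := fun _ : ι => ℂ) j).comp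
      (BoundedContinuousFunction.evalCLM ℝ y)
  calc kernelOp H s k y j = eval (∫ q in Ioi s, kernelMap H s q (k q)) :=
        congrArg eval (integralOp_apply (integrableOn_kernelMap h) k)
    _ = ∫ q in Ioi s, eval (kernelMap H s q (k q)) :=
        (eval.integral_comp_comm (integrable_clm_apply_bounded (integrableOn_kernelMap h) k)).symm
    _ = ∫ q in Ioi s, ∑ l, k q l * H l j (q, max y s) :=
        setIntegral_congr_fun measurableSet_Ioi fun q hq => kernelMap_apply h (le_of_lt hq) _ y j

lemma kernelOp_smul (h : DecayingKernel (n + 1) s H M B) (c : ℂ) (k : RowSpace ι) :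
    kernelOp H s (c • k) = c • kernelOp H s k := by
  ext y j
  simp [kernelOp_apply h, mul_assoc, ← Finset.mul_sum, integral_const_mul]

lemma isCompactOperator_kernelOp (h : DecayingKernel (n + 1) s H M B) :
    IsCompactOperator (kernelOp H s) :=
  isCompactOperator_integralOp (integrableOn_kernelMap h)

end KernelOperator

section ShiftedKernel

set_option maxSynthPendingDepth 3

variable {ι : Type*} [Fintype ι] {s t x : ℝ} {H : ι → ι → ℝ × ℝ → ℂ} {M B : ℝ → ℝ} {u : ι → ℝ}

lemma DecayingKernel.shiftDeriv {n : ℕ} (h : DecayingKernel (n + 1) t H M B) (v : ι → ℝ) :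
    DecayingKernel n t (shiftDeriv H v) (fun x => ‖v‖ * M x) B :=
  h.dirDeriv (norm_nonneg v) fun i j => by
    rw [norm_neg]
    exact max_le (norm_le_pi_norm v i) (norm_le_pi_norm v j)

lemma isLinearMap_kernelMap_shiftDeriv (h : DecayingKernel 1 s H M B) (hx : s ≤ x) :
    IsLinearMap ℝ fun v => kernelMap (shiftDeriv H v) s x where
  map_add v w := by
    ext c y j
    simp [kernelMap_apply (h.shiftDeriv _) hx, shiftDeriv_add, mul_add, Finset.sum_add_distrib]
  map_smul a v := by
    ext c y j
    simp [kernelMap_apply (h.shiftDeriv _) hx, shiftDeriv_smul, Finset.mul_sum, mul_left_comm]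

lemma isLinearMap_kernelOp_shiftDeriv (h : DecayingKernel 2 s H M B) :
    IsLinearMap ℝ fun v => kernelOp (shiftDeriv H v) s where
  map_add v w := by
    have hae : kernelMap (shiftDeriv H (v + w)) s =ᵐ[volume.restrict (Ioi s)]
        kernelMap (shiftDeriv H v) s + kernelMap (shiftDeriv H w) s :=
      (ae_restrict_iff' measurableSet_Ioi).2 (.of_forall fun q hq =>
        (isLinearMap_kernelMap_shiftDeriv (h.of_le one_le_two) (le_of_lt hq)).map_add v w)
    rw [kernelOp, integralOp_congr_ae hae, integralOp_add
      (integrableOn_kernelMap (h.shiftDeriv v)).integrable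
      (integrableOn_kernelMap (h.shiftDeriv w))]
    rfl
  map_smul a v := by
    have hae : kernelMap (shiftDeriv H (a • v)) s =ᵐ[volume.restrict (Ioi s)]
        a • kernelMap (shiftDeriv H v) s :=
      (ae_restrict_iff' measurableSet_Ioi).2 (.of_forall fun q hq =>
        (isLinearMap_kernelMap_shiftDeriv (h.of_le one_le_two) (le_of_lt hq)).map_smul a v)
    rw [kernelOp, integralOp_congr_ae hae,
      integralOp_smul (integrableOn_kernelMap (h.shiftDeriv v))]
    rfl

lemma norm_kernelMap_shiftedKernel_sub_sub_le {w : ι → ℝ}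
    (h : DecayingKernel 2 t (shiftedKernel H u) M B) (hw : ‖w - u‖ ≤ s - t) (hx : s ≤ x) :
    ‖kernelMap (shiftedKernel H w) s x - kernelMap (shiftedKernel H u) s x
      - kernelMap (shiftDeriv (shiftedKernel H u) (w - u)) s x‖
      ≤ Fintype.card ι * (M (x - (s - t)) * B t) * ‖w - u‖ ^ 2 := by
  have hts : t ≤ s := sub_nonneg.1 ((norm_nonneg _).trans hw)
  have hnonneg := h.bound_nonneg (x := x - (s - t)) (by linarith) le_rfl
  rw [mul_assoc]
  refine norm_le_of_apply_eq_sum_mul (by positivity) (fun c y j => ?_)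
    fun l j y => h.norm_shiftedKernel_sub_sub_le hw l j hx (le_max_right y s)
  simp [kernelMap_apply (h.shiftedKernel hw) hx, kernelMap_apply (h.mono hts) hx,
    kernelMap_apply ((h.mono hts).shiftDeriv _) hx, mul_sub, Finset.sum_sub_distrib]

lemma hasFDerivAt_kernelMap_shiftedKernel (h : DecayingKernel 2 t (shiftedKernel H u) M B)
    (hts : t < s) (hx : s ≤ x) {L : (ι → ℝ) →L[ℝ] (ι → ℂ) →L[ℝ] RowSpace ι}
    (hL : ∀ v, L v = kernelMap (shiftDeriv (shiftedKernel H u) v) s x) :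
    HasFDerivAt (fun w => kernelMap (shiftedKernel H w) s x) L u := by
  refine hasFDerivAt_of_eventually_norm_sub_le_sq
    (C := Fintype.card ι * (M (x - (s - t)) * B t)) ?_
  filter_upwards [Metric.closedBall_mem_nhds u (sub_pos.2 hts)] with w hw
  rw [hL]
  exact norm_kernelMap_shiftedKernel_sub_sub_le h (mem_closedBall_iff_norm.1 hw) hx

lemma hasFDerivAt_kernelOp_shiftedKernel (h : DecayingKernel 2 t (shiftedKernel H u) M B)
    (hts : t < s) {L : (ι → ℝ) →L[ℝ] RowSpace ι →L[ℝ] RowSpace ι}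
    (hL : ∀ v, L v = kernelOp (shiftDeriv (shiftedKernel H u) v) s) :
    HasFDerivAt (fun w => kernelOp (shiftedKernel H w) s) L u := by
  have hball := Metric.closedBall_mem_nhds u (sub_pos.2 hts)
  refine hasFDerivAt_integralOp (b := fun q => Fintype.card ι * (M (q - (s - t)) * B t)) ?_
    (fun v => integrableOn_kernelMap ((h.mono hts.le).shiftDeriv v)) hL ?_ ?_
  · filter_upwards [hball] with w hw
    exact integrableOn_kernelMap (h.shiftedKernel (mem_closedBall_iff_norm.1 hw))
  · have := (h.left.comp_sub_const (s - t)).integrableOn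
    rw [add_sub_cancel] at this
    exact ((this.mono_set Ioi_subset_Ici_self).mul_const _).const_mul _
  · filter_upwards [hball] with w hw
    exact (ae_restrict_iff' measurableSet_Ioi).2 (.of_forall fun q hq =>
      norm_kernelMap_shiftedKernel_sub_sub_le h (mem_closedBall_iff_norm.1 hw) (le_of_lt hq))

end ShiftedKernel

section Transform

variable {s t : ℝ}

/-- Lebesgue measure on `(s, ∞)` with a unit mass at `s`. The mass accounts for the inhomogeneous
term of the integral equation. -/
def boundaryMeasure (s : ℝ) : Measure ℝ := Measure.dirac s + volume.restrict (Ioi s)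

instance : SFinite (boundaryMeasure s) := by
  unfold boundaryMeasure
  infer_instance

lemma ae_boundaryMeasure_le : ∀ᵐ q ∂boundaryMeasure s, s ≤ q :=
  ae_add_measure_iff.2 ⟨(ae_dirac_iff measurableSet_Ici).2 le_rfl,
    (ae_restrict_iff' measurableSet_Ioi).2 (.of_forall fun _ hq => le_of_lt hq)⟩

lemma boundaryMeasure_restrict_Ici : (boundaryMeasure s).restrict (Ici s) = boundaryMeasure s :=
  Measure.restrict_eq_self_of_ae_mem ae_boundaryMeasure_le

lemma integrable_boundaryMeasure {E : Type*} [NormedAddCommGroup E] {f : ℝ → E}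
    (hf : IntegrableOn f (Ioi s)) : Integrable f (boundaryMeasure s) :=
  (integrable_dirac (by simp)).add_measure hf

lemma integral_boundaryMeasure {E : Type*} [NormedAddCommGroup E] [NormedSpace ℝ E]
    [CompleteSpace E] {f : ℝ → E} (hf : IntegrableOn f (Ioi s)) :
    ∫ q, f q ∂boundaryMeasure s = f s + ∫ q in Ioi s, f q := by
  rw [boundaryMeasure, integral_add_measure (integrable_dirac (by simp)) hf, integral_dirac]

lemma IsDecayBound.integrable_boundaryMeasure {m : ℝ → ℝ} (hm : IsDecayBound t m) (hts : t ≤ s) :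
    Integrable m (boundaryMeasure s) :=
  _root_.integrable_boundaryMeasure
    (hm.integrableOn.mono_set fun _ hq => hts.trans (le_of_lt hq))

variable {ι : Type*} [Fintype ι] {n : ℕ} {G : ι → ι → ℝ × ℝ → ℂ} {M B : ℝ → ℝ}
  {a b : ℝ → ι → ℂ} {C y : ℝ} {j : ι}

/-- The transform `y ↦ ∑_l a_l(s) G_lj(s, y) + ∫_s^∞ ∑_l a_l(q) G_lj(q, y) dq` of a row. -/
def transform (G : ι → ι → ℝ × ℝ → ℂ) (s : ℝ) (a : ℝ → ι → ℂ) (j : ι) (y : ℝ) : ℂ :=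
  ∫ q, ∑ l, a q l * G l j (q, y) ∂boundaryMeasure s

lemma norm_sum_mul_kernel_le (hG : DecayingKernel n t G M B) (hC : ∀ q, ‖a q‖ ≤ C) {q : ℝ}
    (hq : t ≤ q) (hy : t ≤ y) :
    ‖∑ l, a q l * G l j (q, y)‖ ≤ Fintype.card ι * (C * (M q * B y)) := by
  refine (norm_sum_le _ _).trans
    ((Finset.sum_le_card_nsmul _ _ (C * (M q * B y)) fun l _ => ?_).trans (by simp))
  rw [norm_mul]
  exact mul_le_mul ((norm_le_pi_norm (a q) l).trans (hC q)) (hG.norm_le l j hq hy) (norm_nonneg _)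
    ((norm_nonneg _).trans (hC q))

lemma aestronglyMeasurable_sum_mul_kernel (hG : DecayingKernel n t G M B) (hts : t ≤ s)
    (ha : Measurable a) (hy : t ≤ y) :
    AEStronglyMeasurable (fun q => ∑ l, a q l * G l j (q, y)) (boundaryMeasure s) := by
  have hG' : ∀ l, AEStronglyMeasurable (fun q => G l j (q, y)) (boundaryMeasure s) := fun l => by
    rw [← boundaryMeasure_restrict_Ici]
    refine ContinuousOn.aestronglyMeasurable (fun q hq => ?_) measurableSet_Ici
    exact (ContinuousAt.comp (g := G l j) (f := fun q => (q, y))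
      (hG.contDiffAt l j q (hts.trans hq) y hy).continuousAt (by fun_prop)).continuousWithinAt
  exact Finset.aestronglyMeasurable_fun_sum _ fun l _ =>
    ((measurable_pi_apply l).comp ha).aestronglyMeasurable.mul (hG' l)

lemma integrable_sum_mul_kernel (hG : DecayingKernel n t G M B) (hts : t ≤ s)
    (ha : Measurable a) (hC : ∀ q, ‖a q‖ ≤ C) (hy : t ≤ y) :
    Integrable (fun q => ∑ l, a q l * G l j (q, y)) (boundaryMeasure s) :=
  ((((hG.left.integrable_boundaryMeasure hts).mul_const _).const_mul _).const_mul _).mono'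
    (aestronglyMeasurable_sum_mul_kernel hG hts ha hy)
    (ae_boundaryMeasure_le.mono fun _ hq => norm_sum_mul_kernel_le hG hC (hts.trans hq) hy)

lemma exists_norm_transform_le (hG : DecayingKernel n t G M B) (hts : t ≤ s)
    (hC : ∀ q, ‖a q‖ ≤ C) (j : ι) : ∃ D, ∀ y ≥ t, ‖transform G s a j y‖ ≤ D * B y := by
  refine ⟨∫ q, Fintype.card ι * (C * M q) ∂boundaryMeasure s, fun y hy => ?_⟩
  rw [← integral_mul_const]
  refine norm_integral_le_of_norm_le
    ((((hG.left.integrable_boundaryMeasure hts).const_mul _).const_mul _).mul_const _) ?_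
  filter_upwards [ae_boundaryMeasure_le] with q hq
  exact (norm_sum_mul_kernel_le hG hC (hts.trans hq) hy).trans_eq (by ring)

lemma hasDerivAt_transform (hG : DecayingKernel (n + 1) t G M B) (hts : t < s)
    (ha : Measurable a) (hC : ∀ q, ‖a q‖ ≤ C) (j : ι) (hy : s ≤ y) :
    HasDerivAt (transform G s a j) (transform (fun l j => partialSnd (G l j)) s a j y) y := by
  have hty := hts.trans_le hy
  have hnhds : Ici t ∈ 𝓝 y := Ici_mem_nhds hty
  have hmeas' := aestronglyMeasurable_sum_mul_kernel (j := j) hG.partialSnd hts.le ha hty.le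
  have hbound : ∀ᵐ q ∂boundaryMeasure s, ∀ z ∈ Ici t,
      ‖∑ l, a q l * partialSnd (G l j) (q, z)‖ ≤ Fintype.card ι * (C * (M q * B t)) := by
    filter_upwards [ae_boundaryMeasure_le] with q hq z hz
    refine (norm_sum_mul_kernel_le hG.partialSnd hC (hts.le.trans hq) hz).trans ?_
    have := hG.bound_le_bound (hts.le.trans hq) le_rfl le_rfl hz
    have := (norm_nonneg _).trans (hC q)
    gcongr
  have hderiv : ∀ᵐ q ∂boundaryMeasure s, ∀ z ∈ Ici t, HasDerivAt
      (fun z => ∑ l, a q l * G l j (q, z)) (∑ l, a q l * partialSnd (G l j) (q, z)) z := by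
    filter_upwards [ae_boundaryMeasure_le] with q hq z hz
    exact HasDerivAt.fun_sum fun l _ =>
      (hasDerivAt_partialSnd (hG.differentiableAt l j (hts.le.trans hq) hz)).const_mul (a q l)
  exact (hasDerivAt_integral_of_dominated_loc_of_deriv_le
    (F := fun z q => ∑ l, a q l * G l j (q, z))
    (F' := fun z q => ∑ l, a q l * partialSnd (G l j) (q, z)) hnhds
    (mem_of_superset hnhds fun z hz => aestronglyMeasurable_sum_mul_kernel hG hts.le ha hz)
    (integrable_sum_mul_kernel hG hts.le ha hC hty.le)
    hmeas' hbound
    ((((hG.left.integrable_boundaryMeasure hts.le).mul_const _).const_mul _).const_mul _) hderiv).2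

lemma transform_mul_right (ρ : ι → ℝ → ℂ) :
    transform (fun l m p => G l m p * ρ m p.2) s a j y = transform G s a j y * ρ j y := by
  simp only [transform, ← integral_mul_const, Finset.sum_mul, mul_assoc]

end Transform

section Pairing

variable {ι : Type*} {n : ℕ} {s : ℝ} {D : ι → ι → ℝ × ℝ → ℂ} {M B : ℝ → ℝ}
  {a b β : ℝ → ι → ℂ} {C C' : ℝ}

lemma ae_prod_boundaryMeasure_le :
    ∀ᵐ z ∂(boundaryMeasure s).prod (boundaryMeasure s), s ≤ z.1 ∧ s ≤ z.2 := by
  rw [← boundaryMeasure_restrict_Ici, Measure.prod_restrict]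
  exact ae_restrict_mem (measurableSet_Ici.prod measurableSet_Ici)

lemma aestronglyMeasurable_kernel (hD : DecayingKernel n s D M B) (l m : ι) :
    AEStronglyMeasurable (D l m) ((boundaryMeasure s).prod (boundaryMeasure s)) := by
  rw [← boundaryMeasure_restrict_Ici, Measure.prod_restrict]
  exact ContinuousOn.aestronglyMeasurable
    (fun z hz => (hD.contDiffAt l m z.1 hz.1 z.2 hz.2).continuousAt.continuousWithinAt)
    (measurableSet_Ici.prod measurableSet_Ici)

variable [Fintype ι]

lemma integrable_prod_sum_mul_sum_mul_kernel (hD : DecayingKernel n s D M B)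
    (ha : Measurable a) (hC : ∀ q, ‖a q‖ ≤ C)
    (hβ : AEStronglyMeasurable β (boundaryMeasure s)) (hC' : ∀ q ≥ s, ‖β q‖ ≤ C') :
    Integrable (fun z : ℝ × ℝ => ∑ m, β z.2 m * ∑ l, a z.1 l * D l m z)
      ((boundaryMeasure s).prod (boundaryMeasure s)) := by
  refine Integrable.mono' (((hD.left.integrable_boundaryMeasure le_rfl).mul_prod
    (hD.right.integrable_boundaryMeasure le_rfl)).const_mul
      (Fintype.card ι * (C' * (Fintype.card ι * C)))) ?_ ?_
  · refine Finset.aestronglyMeasurable_fun_sum _ fun m _ => AEStronglyMeasurable.mul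
      ((continuous_apply m).comp_aestronglyMeasurable hβ.comp_snd)
      (Finset.aestronglyMeasurable_fun_sum _ fun l _ => AEStronglyMeasurable.mul ?_
        (aestronglyMeasurable_kernel hD l m))
    exact ((measurable_pi_apply l).comp (ha.comp measurable_fst)).aestronglyMeasurable
  · filter_upwards [ae_prod_boundaryMeasure_le] with z hz
    refine (norm_sum_le _ _).trans ((Finset.sum_le_card_nsmul _ _
      (C' * (Fintype.card ι * (C * (M z.1 * B z.2)))) fun m _ => ?_).trans_eq ?_)
    · rw [norm_mul]
      exact mul_le_mul ((norm_le_pi_norm (β z.2) m).trans (hC' z.2 hz.2))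
        (norm_sum_mul_kernel_le hD hC hz.1 hz.2) (norm_nonneg _)
        ((norm_nonneg _).trans (hC' z.2 hz.2))
    · simp [mul_assoc]

lemma integral_sum_mul_transform (hD : DecayingKernel n s D M B) (ha : Measurable a)
    (hC : ∀ q, ‖a q‖ ≤ C) :
    ∫ q, ∑ m, β q m * transform D s a m q ∂boundaryMeasure s
      = ∫ q, ∫ p, ∑ m, β q m * ∑ l, a p l * D l m (p, q) ∂boundaryMeasure s
          ∂boundaryMeasure s := by
  refine integral_congr_ae (ae_boundaryMeasure_le.mono fun q hq => ?_)
  simp only [transform, ← integral_const_mul]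
  exact (integral_finsetSum _ fun m _ =>
    (integrable_sum_mul_kernel hD le_rfl ha hC hq).const_mul (β q m)).symm

lemma integral_sum_mul_transform_add_eq_zero {ρ : ι → ℝ → ℂ} (hD : DecayingKernel n s D M B)
    (hskew : ∀ l m, ∀ p ≥ s, ∀ q ≥ s, ρ m q * D l m (p, q) = -(ρ l p * D m l (q, p)))
    (ha : Measurable a) (haC : ∀ q, ‖a q‖ ≤ C) (hb : Measurable b) (hbC : ∀ q, ‖b q‖ ≤ C)
    (hρb : AEStronglyMeasurable (fun q m => b q m * ρ m q) (boundaryMeasure s))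
    (hρbC : ∀ q ≥ s, ‖fun m => b q m * ρ m q‖ ≤ C') :
    ∫ q, ∑ m, b q m * ρ m q * transform D s a m q ∂boundaryMeasure s
      + ∫ q, ∑ m, a q m * ρ m q * transform D s b m q ∂boundaryMeasure s = 0 := by
  have hint := integrable_prod_sum_mul_sum_mul_kernel hD ha haC hρb hρbC
  have hswap := integral_integral_swap
    (f := fun p q => ∑ m, b q m * ρ m q * ∑ l, a p l * D l m (p, q)) hint
  rw [integral_sum_mul_transform (β := fun q m => b q m * ρ m q) hD ha haC,
    integral_sum_mul_transform (β := fun q m => a q m * ρ m q) hD hb hbC, ← hswap,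
    add_eq_zero_iff_eq_neg, ← integral_neg]
  refine integral_congr_ae (ae_boundaryMeasure_le.mono fun q hq => ?_)
  simp only [← integral_neg]
  refine integral_congr_ae (ae_boundaryMeasure_le.mono fun p hp => ?_)
  simp only [Finset.mul_sum, ← Finset.sum_neg_distrib]
  rw [Finset.sum_comm]
  refine Finset.sum_congr rfl fun l _ => Finset.sum_congr rfl fun m _ => ?_
  linear_combination b p m * a q l * hskew l m q hq p hp

end Pairing

section QuadraticRelation

variable {ι : Type*} [Fintype ι] {n : ℕ} {s t : ℝ} {G H : ι → ι → ℝ × ℝ → ℂ} {M B : ℝ → ℝ}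
  {a b : ℝ → ι → ℂ} {C : ℝ} {i i' : ι} {ρ : ι → ℝ → ℂ}

lemma exists_norm_transform_le_const (hG : DecayingKernel n t G M B) (hts : t ≤ s)
    (hC : ∀ q, ‖a q‖ ≤ C) : ∃ D, ∀ q ≥ s, ∀ j, ‖transform G s a j q‖ ≤ D := by
  choose D hD using fun j => exists_norm_transform_le hG hts hC j
  refine ⟨∑ j, |D j| * B s, fun q hq j => ?_⟩
  have hB := hG.right.mono hts
  calc ‖transform G s a j q‖ ≤ |D j| * B q :=
        (hD j q (hts.trans hq)).trans
          (mul_le_mul_of_nonneg_right (le_abs_self _) (hB.nonneg hq))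
    _ ≤ |D j| * B s := mul_le_mul_of_nonneg_left (hB.le_apply le_rfl hq) (abs_nonneg _)
    _ ≤ ∑ j, |D j| * B s := Finset.single_le_sum (f := fun j => |D j| * B s)
        (fun _ _ => mul_nonneg (abs_nonneg _) (hB.nonneg le_rfl)) (Finset.mem_univ j)

lemma continuousOn_transform (hG : DecayingKernel (n + 1) t G M B) (hts : t < s)
    (ha : Measurable a) (hC : ∀ q, ‖a q‖ ≤ C) (j : ι) :
    ContinuousOn (transform G s a j) (Ici s) := fun _ hq =>
  (hasDerivAt_transform hG hts ha hC j hq).continuousAt.continuousWithinAt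

lemma integrableOn_of_norm_le_mul_bound {f : ℝ → ℂ} {D : ℝ} (hB : IsDecayBound t B)
    (hts : t ≤ s) (hf : AEStronglyMeasurable f (volume.restrict (Ioi s)))
    (hD : ∀ q ≥ t, ‖f q‖ ≤ D * B q) : IntegrableOn f (Ioi s) :=
  ((hB.integrableOn.mono_set fun _ hq => hts.trans (le_of_lt hq)).const_mul D).mono' hf
    ((ae_restrict_iff' measurableSet_Ioi).2
      (.of_forall fun q hq => hD q (hts.trans (le_of_lt hq))))

lemma integrableOn_transform (hG : DecayingKernel (n + 1) t G M B) (hts : t < s)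
    (ha : Measurable a) (hC : ∀ q, ‖a q‖ ≤ C) (j : ι) :
    IntegrableOn (transform G s a j) (Ioi s) := by
  obtain ⟨D, hD⟩ := exists_norm_transform_le hG hts.le hC j
  exact integrableOn_of_norm_le_mul_bound hG.right hts.le
    (((continuousOn_transform hG hts ha hC j).mono Ioi_subset_Ici_self).aestronglyMeasurable
      measurableSet_Ioi) hD

lemma integrableOn_transform_partialSnd (hG : DecayingKernel (n + 1) t G M B) (hts : t < s)
    (ha : Measurable a) (hC : ∀ q, ‖a q‖ ≤ C) (j : ι) :
    IntegrableOn (transform (fun l j => partialSnd (G l j)) s a j) (Ioi s) := by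
  obtain ⟨D, hD⟩ := exists_norm_transform_le hG.partialSnd hts.le hC j
  refine integrableOn_of_norm_le_mul_bound hG.right hts.le ?_ hD
  refine (stronglyMeasurable_deriv (transform G s a j)).aestronglyMeasurable.congr
    ((ae_restrict_iff' measurableSet_Ioi).2 (.of_forall fun q hq => ?_))
  exact (hasDerivAt_transform hG hts ha hC j (le_of_lt hq)).deriv

lemma integrableOn_transform_mul (hG : DecayingKernel (n + 1) t G M B) (hts : t < s)
    (ha : Measurable a) (hC : ∀ q, ‖a q‖ ≤ C) (j : ι) {f : ℝ → ℂ}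
    (hf : IntegrableOn f (Ioi s)) : IntegrableOn (fun q => transform G s a j q * f q) (Ioi s) := by
  obtain ⟨D, hD⟩ := exists_norm_transform_le_const hG hts.le hC
  exact Integrable.bdd_mul hf
    (((continuousOn_transform hG hts ha hC j).mono Ioi_subset_Ici_self).aestronglyMeasurable
      measurableSet_Ioi)
    ((ae_restrict_iff' measurableSet_Ioi).2 (.of_forall fun q hq => hD q (le_of_lt hq) j))

lemma integral_sum_transform_mul_add (hG : DecayingKernel (n + 1) t G M B) (hts : t < s)
    (ha : Measurable a) (haC : ∀ q, ‖a q‖ ≤ C) (hb : Measurable b) (hbC : ∀ q, ‖b q‖ ≤ C) :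
    (∫ q in Ioi s, ∑ m, transform G s b m q * transform (fun l m => partialSnd (G l m)) s a m q)
      + ∫ q in Ioi s, ∑ m, transform G s a m q * transform (fun l m => partialSnd (G l m)) s b m q
      = -∑ m, transform G s a m s * transform G s b m s := by
  have hab : IntegrableOn (fun q => ∑ m, transform G s b m q
      * transform (fun l m => partialSnd (G l m)) s a m q) (Ioi s) :=
    integrable_finsetSum _ fun m _ => integrableOn_transform_mul hG hts hb hbC m
      (integrableOn_transform_partialSnd hG hts ha haC m)
  have hba : IntegrableOn (fun q => ∑ m, transform G s a m q
      * transform (fun l m => partialSnd (G l m)) s b m q) (Ioi s) :=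
    integrable_finsetSum _ fun m _ => integrableOn_transform_mul hG hts ha haC m
      (integrableOn_transform_partialSnd hG hts hb hbC m)
  have hprod : IntegrableOn (fun q => ∑ m, transform G s a m q * transform G s b m q) (Ioi s) :=
    integrable_finsetSum _ fun m _ => integrableOn_transform_mul hG hts ha haC m
      (integrableOn_transform hG hts hb hbC m)
  rw [← integral_add hab hba]
  refine integral_Ioi_eq_neg_of_hasDerivAt_of_integrableOn (fun q hq => ?_) (hab.add hba) hprod
  convert HasDerivAt.fun_sum (u := Finset.univ) fun m _ =>
    (hasDerivAt_transform hG hts ha haC m hq).fun_mul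
      (hasDerivAt_transform hG hts hb hbC m hq) using 1
  rw [Pi.add_apply, ← Finset.sum_add_distrib]
  exact Finset.sum_congr rfl fun m _ => by ring

variable [DecidableEq ι]

/-- `a` is the row `k` of index `i` of a solution of the integral equation, extended by the unit
vector `e_i` at the boundary point `s`. With this convention the equation reads
`k_j = transform H s a j`. -/
structure IsExtendedSolution (H : ι → ι → ℝ × ℝ → ℂ) (s : ℝ) (i : ι) (a : ℝ → ι → ℂ) :
    Prop where
  measurable : Measurable a
  bounded : ∃ C, ∀ q, ‖a q‖ ≤ C
  boundary : a s = Pi.single i 1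
  equation : ∀ q > s, ∀ j, a q j = transform H s a j q

/-- The kernel `H_lm(p, q) ρ_m(q)`. -/
def weightedKernel (ρ : ι → ℝ → ℂ) (H : ι → ι → ℝ × ℝ → ℂ) (l m : ι) (p : ℝ × ℝ) : ℂ :=
  H l m p * ρ m p.2

namespace IsExtendedSolution

lemma mul_weight_eq_transform (ha : IsExtendedSolution H s i a) (ρ : ι → ℝ → ℂ) {q : ℝ}
    (hq : s < q) (j : ι) : a q j * ρ j q = transform (weightedKernel ρ H) s a j q := by
  rw [ha.equation q hq j]
  exact (transform_mul_right ρ).symm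

lemma aestronglyMeasurable_mul_weight (ha : IsExtendedSolution H s i a)
    (hW : DecayingKernel (n + 1) t (weightedKernel ρ H) M B) (hts : t < s) :
    AEStronglyMeasurable (fun q m => a q m * ρ m q) (boundaryMeasure s) := by
  obtain ⟨C, hC⟩ := ha.bounded
  refine AEStronglyMeasurable.add_measure aestronglyMeasurable_dirac ?_
  refine ContinuousOn.aestronglyMeasurable (continuousOn_pi.2 fun m => ?_) measurableSet_Ioi
  exact ((continuousOn_transform hW hts ha.measurable hC m).mono Ioi_subset_Ici_self).congr
    fun q hq => ha.mul_weight_eq_transform ρ hq m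

lemma exists_norm_mul_weight_le (ha : IsExtendedSolution H s i a)
    (hW : DecayingKernel n t (weightedKernel ρ H) M B) (hts : t ≤ s) :
    ∃ D, ∀ q ≥ s, ‖fun m => a q m * ρ m q‖ ≤ D := by
  obtain ⟨C, hC⟩ := ha.bounded
  obtain ⟨D, hD⟩ := exists_norm_transform_le_const hW hts hC
  refine ⟨max ‖fun m => a s m * ρ m s‖ (max D 0), fun q hq => ?_⟩
  rcases hq.eq_or_lt with rfl | hsq
  · exact le_max_left _ _
  · refine le_max_of_le_right ((pi_norm_le_iff_of_nonneg (le_max_right _ _)).2 fun m => ?_)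
    rw [ha.mul_weight_eq_transform ρ hsq m]
    exact (hD q hq m).trans (le_max_left _ _)

lemma integral_sum_mul_transform_partialSnd (ha : Measurable a) (hC : ∀ q, ‖a q‖ ≤ C)
    (hb : IsExtendedSolution H s i b)
    (hW : DecayingKernel (n + 1) t (weightedKernel ρ H) M B) (hts : t < s) :
    ∫ q, ∑ m, b q m * ρ m q * transform (fun l m => partialSnd (weightedKernel ρ H l m)) s a m q
        ∂boundaryMeasure s
      = ρ i s * transform (fun l m => partialSnd (weightedKernel ρ H l m)) s a i s
        + ∫ q in Ioi s, ∑ m, transform (weightedKernel ρ H) s b m q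
          * transform (fun l m => partialSnd (weightedKernel ρ H l m)) s a m q := by
  obtain ⟨C', hC'⟩ := hb.bounded
  have heq : EqOn (fun q => ∑ m, b q m * ρ m q
        * transform (fun l m => partialSnd (weightedKernel ρ H l m)) s a m q)
      (fun q => ∑ m, transform (weightedKernel ρ H) s b m q
        * transform (fun l m => partialSnd (weightedKernel ρ H l m)) s a m q) (Ioi s) :=
    fun q hq => Finset.sum_congr rfl fun m _ => by rw [hb.mul_weight_eq_transform ρ hq m]
  have hint : IntegrableOn (fun q => ∑ m, transform (weightedKernel ρ H) s b m q
      * transform (fun l m => partialSnd (weightedKernel ρ H l m)) s a m q) (Ioi s) :=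
    integrable_finsetSum _ fun m _ => integrableOn_transform_mul hW hts hb.measurable hC' m
      (integrableOn_transform_partialSnd hW hts ha hC m)
  rw [integral_boundaryMeasure (hint.congr_fun heq.symm measurableSet_Ioi),
    setIntegral_congr_fun measurableSet_Ioi heq, hb.boundary]
  simp [Pi.single_apply]

/-- If the kernel `ρ_m(q) ∂W_lm(p, q)/∂q` is antisymmetric, where `W_lm(p, q) = H_lm(p, q) ρ_m(q)`,
then pairing two rows of the solution with it leaves only boundary terms. -/
lemma weight_mul_transform_add (ha : IsExtendedSolution H s i a)
    (hb : IsExtendedSolution H s i' b)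
    (hW : DecayingKernel (n + 1) t (weightedKernel ρ H) M B) (hts : t < s)
    (hskew : ∀ l m, ∀ p ≥ s, ∀ q ≥ s, ρ m q * partialSnd (weightedKernel ρ H l m) (p, q)
      = -(ρ l p * partialSnd (weightedKernel ρ H m l) (q, p))) :
    ρ i' s * transform (fun l m => partialSnd (weightedKernel ρ H l m)) s a i' s
      + ρ i s * transform (fun l m => partialSnd (weightedKernel ρ H l m)) s b i s
      = ∑ m, transform (weightedKernel ρ H) s a m s * transform (weightedKernel ρ H) s b m s := by
  obtain ⟨Ca, hCa⟩ := ha.bounded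
  obtain ⟨Cb, hCb⟩ := hb.bounded
  obtain ⟨D, hD⟩ := hb.exists_norm_mul_weight_le hW hts.le
  have haC : ∀ q, ‖a q‖ ≤ max Ca Cb := fun q => (hCa q).trans (le_max_left _ _)
  have hbC : ∀ q, ‖b q‖ ≤ max Ca Cb := fun q => (hCb q).trans (le_max_right _ _)
  have hpair := integral_sum_mul_transform_add_eq_zero (hW.partialSnd.mono hts.le) hskew
    ha.measurable haC hb.measurable hbC (hb.aestronglyMeasurable_mul_weight hW hts) hD
  rw [integral_sum_mul_transform_partialSnd ha.measurable haC hb hW hts,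
    integral_sum_mul_transform_partialSnd hb.measurable hbC ha hW hts] at hpair
  linear_combination
    hpair - integral_sum_transform_mul_add hW hts ha.measurable haC hb.measurable hbC

end IsExtendedSolution

end QuadraticRelation

section RowDerivative

set_option maxSynthPendingDepth 3

variable {ι : Type*} {n : ℕ} {s t y : ℝ} {G : ι → ι → ℝ × ℝ → ℂ} {M B : ℝ → ℝ}
  {a : ℝ → ι → ℂ} {C : ℝ} {i j m : ι} {u : ι → ℝ}

lemma DecayingKernel.integrableOn_left (hG : DecayingKernel n t G M B) (hts : t ≤ s) (l j : ι)
    (hy : t ≤ y) : IntegrableOn (fun q => G l j (q, y)) (Ioi s) := by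
  have hcont : ContinuousOn (fun q => G l j (q, y)) (Ici t) := fun q hq =>
    (ContinuousAt.comp (g := G l j) (f := fun q => (q, y))
      (hG.contDiffAt l j q hq y hy).continuousAt (by fun_prop)).continuousWithinAt
  refine IntegrableOn.mono_set ?_ (Ioi_subset_Ici hts)
  exact (hG.left.integrableOn.mul_const (B y)).mono'
    (hcont.aestronglyMeasurable measurableSet_Ici)
    ((ae_restrict_iff' measurableSet_Ici).2 (.of_forall fun q hq => hG.norm_le l j hq hy))

lemma shiftDeriv_single [DecidableEq ι] (G : ι → ι → ℝ × ℝ → ℂ) (m l j : ι) (p : ℝ × ℝ) :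
    shiftDeriv G (Pi.single m 1) l j p
      = -(if l = m then partialFst (G l j) p else 0)
        - (if j = m then partialSnd (G l j) p else 0) := by
  have hsplit : -((Pi.single m (1 : ℝ) : ι → ℝ) l, (Pi.single m (1 : ℝ) : ι → ℝ) j)
      = -(if l = m then ((1, 0) : ℝ × ℝ) else 0) - (if j = m then ((0, 1) : ℝ × ℝ) else 0) := by
    by_cases hl : l = m <;> by_cases hj : j = m <;> simp [hl, hj]
  rw [shiftDeriv, dirDeriv, hsplit, map_sub, map_neg]
  by_cases hl : l = m <;> by_cases hj : j = m <;> simp [hl, hj, partialFst, partialSnd]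

variable [Fintype ι]

lemma integral_transform_partialSnd_mul {f f' : ℝ → ℂ} (hG : DecayingKernel (n + 2) t G M B)
    (hts : t < s) (ha : Measurable a) (hC : ∀ q, ‖a q‖ ≤ C) (m : ι)
    (hderiv : ∀ q ≥ s, HasDerivAt f (f' q) q) (hf : IntegrableOn f (Ioi s))
    (hf' : IntegrableOn f' (Ioi s)) :
    ∫ q in Ioi s, transform (fun l j => partialSnd (G l j)) s a m q * f q
      = -(transform G s a m s * f s) - ∫ q in Ioi s, transform G s a m q * f' q := by
  have hint := integrableOn_transform_mul hG.partialSnd hts ha hC m hf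
  have hint' := integrableOn_transform_mul hG hts ha hC m hf'
  rw [eq_sub_iff_add_eq, ← integral_add hint hint']
  exact integral_Ioi_eq_neg_of_hasDerivAt_of_integrableOn
    (fun q hq => (hasDerivAt_transform hG hts ha hC m hq).fun_mul (hderiv q hq))
    (hint.add hint') (integrableOn_transform_mul hG hts ha hC m hf)

lemma differentiableAt_row_and_fderiv_row {H : ι → ι → ℝ × ℝ → ℂ} {κ : (ι → ℝ) → RowSpace ι}
    {c : ι → ℂ} (h : DecayingKernel 2 t (shiftedKernel H u) M B) (hts : t < s)
    (hinj : ∀ k, k = kernelOp (shiftedKernel H u) s k → k = 0)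
    (hκ : ∀ᶠ w in 𝓝 u, κ w
      = kernelMap (shiftedKernel H w) s s c + kernelOp (shiftedKernel H w) s (κ w)) :
    DifferentiableAt ℝ κ u ∧ ∀ v, fderiv ℝ κ u v
      = kernelMap (shiftDeriv (shiftedKernel H u) v) s s c
        + kernelOp (shiftDeriv (shiftedKernel H u) v) s (κ u)
        + kernelOp (shiftedKernel H u) s (fderiv ℝ κ u v) := by
  have hs := h.mono hts.le
  let map' :=
    (isLinearMap_kernelMap_shiftDeriv (hs.of_le one_le_two) le_rfl).mk'.toContinuousLinearMap
  let op' := (isLinearMap_kernelOp_shiftDeriv hs).mk'.toContinuousLinearMap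
  have hmap : HasFDerivAt (fun w => kernelMap (shiftedKernel H w) s s) map' u :=
    hasFDerivAt_kernelMap_shiftedKernel h hts le_rfl fun v => rfl
  have hop : HasFDerivAt (fun w => kernelOp (shiftedKernel H w) s) op' u :=
    hasFDerivAt_kernelOp_shiftedKernel h hts fun v => rfl
  have hrow := hmap.clm_apply (hasFDerivAt_const c u)
  have hdiff := differentiableAt_of_eq_add_clm_apply hop.differentiableAt hrow.differentiableAt
    (isUnit_one_sub_of_isCompactOperator (isCompactOperator_kernelOp hs) hinj) hκ
  refine ⟨hdiff, fun v => ?_⟩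
  simpa [map', op'] using fderiv_apply_of_eq_add_clm_apply hop hrow hdiff hκ v

variable [DecidableEq ι] {k : RowSpace ι} {H : ι → ι → ℝ × ℝ → ℂ}

lemma transform_shiftDeriv_single_add (hG : DecayingKernel (n + 1) t G M B) (hts : t ≤ s)
    (ha : Measurable a) (hC : ∀ q, ‖a q‖ ≤ C) (j m : ι) (hy : t ≤ y) :
    transform (shiftDeriv G (Pi.single m 1)) s a j y
        + (if j = m then transform (fun l j => partialSnd (G l j)) s a j y else 0)
      = -∫ q, a q m * partialFst (G m j) (q, y) ∂boundaryMeasure s := by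
  have hint := integrable_sum_mul_kernel (j := j) (hG.shiftDeriv (Pi.single m 1)) hts ha hC hy
  have hint' := integrable_sum_mul_kernel (j := j) hG.partialSnd hts ha hC hy
  rw [← integral_neg]
  split_ifs with hj
  · rw [transform, transform, ← integral_add hint hint']
    congr 1 with q
    simp [shiftDeriv_single, hj, mul_sub, Finset.sum_sub_distrib]
  · rw [transform, add_zero]
    congr 1 with q
    simp [shiftDeriv_single, hj]

/-- Integration by parts in `q` moves the derivative of the kernel onto the solution. -/
lemma IsExtendedSolution.transform_shiftDeriv_single_add (ha : IsExtendedSolution G s i a)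
    (hG : DecayingKernel (n + 2) t G M B) (hts : t < s) (hmi : m ≠ i) (j : ι) (hy : t ≤ y) :
    transform (shiftDeriv G (Pi.single m 1)) s a j y
        + (if j = m then transform (fun l j => partialSnd (G l j)) s a j y else 0)
      = transform G s a m s * G m j (s, y)
        + ∫ q in Ioi s, transform (fun l j => partialSnd (G l j)) s a m q * G m j (q, y) := by
  obtain ⟨C, hC⟩ := ha.bounded
  have hG' : IntegrableOn (fun q => partialFst (G m j) (q, y)) (Ioi s) :=
    hG.partialFst.integrableOn_left hts.le m j hy
  have heq : EqOn (fun q => a q m * partialFst (G m j) (q, y))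
      (fun q => transform G s a m q * partialFst (G m j) (q, y)) (Ioi s) := fun q hq => by
    simp only [ha.equation q hq m]
  have hint := (integrableOn_transform_mul hG hts ha.measurable hC m hG').congr_fun heq.symm
    measurableSet_Ioi
  rw [_root_.transform_shiftDeriv_single_add hG hts.le ha.measurable hC j m hy,
    integral_boundaryMeasure hint, setIntegral_congr_fun measurableSet_Ioi heq, ha.boundary,
    integral_transform_partialSnd_mul hG hts ha.measurable hC m
      (fun q hq => hasDerivAt_partialFst (hG.differentiableAt m j (hts.le.trans hq) hy))
      (hG.integrableOn_left hts.le m j hy) hG', Pi.single_eq_of_ne hmi]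
  ring

/-- The row `k`, extended by the unit vector `e_i` at `s`. -/
def extendedRow (s : ℝ) (i : ι) (k : RowSpace ι) : ℝ → ι → ℂ :=
  Function.update k s (Pi.single i 1)

lemma measurable_extendedRow (s : ℝ) (i : ι) (k : RowSpace ι) :
    Measurable (extendedRow s i k) := by
  classical
  have : extendedRow s i k = ({s} : Set ℝ).piecewise (fun _ => Pi.single i 1) k := by
    rw [piecewise_singleton, extendedRow]
  rw [this]
  exact measurable_const.piecewise (measurableSet_singleton s) k.continuous.measurable

lemma norm_extendedRow_le (s : ℝ) (i : ι) (k : RowSpace ι) (q : ℝ) :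
    ‖extendedRow s i k q‖ ≤ max ‖k‖ ‖(Pi.single i 1 : ι → ℂ)‖ := by
  by_cases hq : q = s
  · simp [extendedRow, hq]
  · simpa [extendedRow, hq] using Or.inl (k.norm_coe_le_norm q)

lemma kernelMap_add_kernelOp_apply (hG : DecayingKernel (n + 1) s G M B) (y : ℝ) (j : ι) :
    (kernelMap G s s (Pi.single i 1) + kernelOp G s k) y j
      = transform G s (extendedRow s i k) j (max y s) := by
  have hint := integrable_sum_mul_kernel (j := j) hG le_rfl (measurable_extendedRow s i k)
    (norm_extendedRow_le s i k) (le_max_right y s)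
  have hrow : EqOn (fun q => ∑ l, extendedRow s i k q l * G l j (q, max y s))
      (fun q => ∑ l, k q l * G l j (q, max y s)) (Ioi s) := fun q hq => by
    simp [extendedRow, (mem_Ioi.1 hq).ne']
  rw [transform, integral_boundaryMeasure hint.right_of_add_measure,
    setIntegral_congr_fun measurableSet_Ioi hrow]
  simp [extendedRow, kernelMap_apply hG le_rfl, kernelOp_apply hG]

lemma apply_eq_transform_extendedRow (hG : DecayingKernel (n + 1) s G M B)
    (hk : k = kernelMap G s s (Pi.single i 1) + kernelOp G s k) (hy : s ≤ y) (j : ι) :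
    k y j = transform G s (extendedRow s i k) j y := by
  conv_lhs => rw [hk, kernelMap_add_kernelOp_apply hG, max_eq_left hy]

lemma isExtendedSolution_extendedRow (hG : DecayingKernel (n + 1) s G M B)
    (hk : k = kernelMap G s s (Pi.single i 1) + kernelOp G s k) :
    IsExtendedSolution G s i (extendedRow s i k) where
  measurable := measurable_extendedRow s i k
  bounded := ⟨_, norm_extendedRow_le s i k⟩
  boundary := Function.update_self ..
  equation q hq j := by
    rw [← apply_eq_transform_extendedRow hG hk hq.le, extendedRow, Function.update_of_ne hq.ne']

/-- The row `y ↦ ∂_y (∑_l a_l G_lm)(y) e_m`, `y ≥ s`, supported in the column `m`. -/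
def columnRow (G : ι → ι → ℝ × ℝ → ℂ) (s : ℝ) (a : ℝ → ι → ℂ) (m : ι) : RowSpace ι :=
  toBounded fun y j =>
    if j = m then transform (fun l j => partialSnd (G l j)) s a j (max y s) else 0

lemma columnRow_apply (hG : DecayingKernel (n + 2) t G M B) (hts : t < s) (ha : Measurable a)
    (hC : ∀ q, ‖a q‖ ≤ C) (m : ι) (y : ℝ) (j : ι) :
    columnRow G s a m y j
      = if j = m then transform (fun l j => partialSnd (G l j)) s a j (max y s) else 0 := by
  obtain ⟨D, hD⟩ := exists_norm_transform_le_const hG.partialSnd hts.le hC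
  have hcont : Continuous fun y j =>
      if j = m then transform (fun l j => partialSnd (G l j)) s a j (max y s) else 0 := by
    refine continuous_pi fun j => ?_
    split_ifs
    · exact (continuousOn_transform hG.partialSnd hts ha hC j).comp_continuous
        (continuous_id.max continuous_const) fun y => le_max_right y s
    · exact continuous_const
  rw [columnRow, toBounded_apply hcont (C := max D 0) fun y => ?_]
  refine (pi_norm_le_iff_of_nonneg (le_max_right D 0)).2 fun j => ?_
  split_ifs
  · exact (hD _ (le_max_right y s) j).trans (le_max_left D 0)
  · simp

lemma kernelOp_columnRow_apply (hG : DecayingKernel (n + 2) t G M B) (hts : t < s)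
    (ha : Measurable a) (hC : ∀ q, ‖a q‖ ≤ C) (m : ι) (y : ℝ) (j : ι) :
    kernelOp G s (columnRow G s a m) y j
      = ∫ q in Ioi s, transform (fun l j => partialSnd (G l j)) s a m q
          * G m j (q, max y s) := by
  rw [kernelOp_apply (hG.mono hts.le)]
  refine setIntegral_congr_fun measurableSet_Ioi fun q hq => ?_
  simp [columnRow_apply hG hts ha hC, max_eq_left (le_of_lt (mem_Ioi.1 hq))]

lemma kernelMap_add_kernelOp_shiftDeriv_single_add (hG : DecayingKernel (n + 2) t G M B)
    (hts : t < s) (hk : k = kernelMap G s s (Pi.single i 1) + kernelOp G s k) (hmi : m ≠ i) :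
    kernelMap (shiftDeriv G (Pi.single m 1)) s s (Pi.single i 1)
        + kernelOp (shiftDeriv G (Pi.single m 1)) s k + columnRow G s (extendedRow s i k) m
      = k s m • kernelMap G s s (Pi.single m 1)
        + kernelOp G s (columnRow G s (extendedRow s i k) m) := by
  have hs := hG.mono hts.le
  have hmeas := measurable_extendedRow s i k
  have hbound := norm_extendedRow_le s i k
  ext y j
  have hparts := (isExtendedSolution_extendedRow hs hk).transform_shiftDeriv_single_add hG hts hmi
    j (hts.le.trans (le_max_right y s))
  rw [BoundedContinuousFunction.add_apply, Pi.add_apply,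
    kernelMap_add_kernelOp_apply (hs.shiftDeriv _), columnRow_apply hG hts hmeas hbound, hparts,
    BoundedContinuousFunction.add_apply, Pi.add_apply,
    kernelOp_columnRow_apply hG hts hmeas hbound, apply_eq_transform_extendedRow hs hk le_rfl]
  simp [kernelMap_apply hs le_rfl, Pi.single_apply]

/-- The derivative of the solution in the direction `uᵐ`, corrected in the column `m`, solves the
equation of a multiple of the row `m`, hence equals it by uniqueness. -/
lemma fderiv_row_single {k : (ι → ℝ) → ι → RowSpace ι}
    (h : DecayingKernel 2 t (shiftedKernel H u) M B) (hts : t < s)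
    (hinj : ∀ k, k = kernelOp (shiftedKernel H u) s k → k = 0)
    (hk : ∀ i, ∀ᶠ w in 𝓝 u, k w i = kernelMap (shiftedKernel H w) s s (Pi.single i 1)
      + kernelOp (shiftedKernel H w) s (k w i)) (hmi : m ≠ i) :
    fderiv ℝ (fun w => k w i) u (Pi.single m 1)
        + columnRow (shiftedKernel H u) s (extendedRow s i (k u i)) m
      = k u i s m • k u m := by
  set G := shiftedKernel H u
  set D := fderiv ℝ (fun w => k w i) u (Pi.single m 1)
  set a := extendedRow s i (k u i)
  have hs := h.mono hts.le
  have hi : k u i = kernelMap G s s (Pi.single i 1) + kernelOp G s (k u i) :=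
    (hk i).self_of_nhds
  have hm : k u m = kernelMap G s s (Pi.single m 1) + kernelOp G s (k u m) :=
    (hk m).self_of_nhds
  have hD : D = kernelMap (shiftDeriv G (Pi.single m 1)) s s (Pi.single i 1)
      + kernelOp (shiftDeriv G (Pi.single m 1)) s (k u i) + kernelOp G s D :=
    (differentiableAt_row_and_fderiv_row h hts hinj (hk i)).2 _
  have hparts := kernelMap_add_kernelOp_shiftDeriv_single_add h hts hi hmi
  refine sub_eq_zero.1 (hinj _ ?_)
  rw [map_sub, map_add, kernelOp_smul hs]
  linear_combination (norm := module) hD + hparts - k u i s m • hm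

end RowDerivative

section Decay

variable {α : Type*} [Fintype α] {t : ℝ}

lemma IsDecayBound.sum {m : α → ℝ → ℝ} (h : ∀ a, IsDecayBound t (m a)) :
    IsDecayBound t fun x => ∑ a, m a x where
  antitoneOn _ hx _ hy hxy := Finset.sum_le_sum fun a _ => (h a).antitoneOn hx hy hxy
  integrableOn := integrable_finsetSum _ fun a _ => (h a).integrableOn

lemma IsDecayBound.le_sum {m : α → ℝ → ℝ} (h : ∀ a, IsDecayBound t (m a)) (a : α) {x : ℝ}
    (hx : t ≤ x) : m a x ≤ ∑ a, m a x :=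
  Finset.single_le_sum (f := fun a => m a x) (fun a _ => (h a).nonneg hx) (Finset.mem_univ a)

lemma isOpen_quadrant {A B : Set ℝ} (hA : IsOpen A) (hB : IsOpen B) : IsOpen (quadrant A B) :=
  (hA.preimage continuous_fst.neg).inter (hB.preimage continuous_snd.neg)

lemma Decays.mono {n n' : ℕ} {A B : Set ℝ} {H : ℝ × ℝ → ℂ} (h : Decays n A B H) (hn : n' ≤ n) :
    Decays n' A B H := by
  refine ⟨h.1.of_le (by exact_mod_cast hn), fun x₀ y₀ hx hy => ?_⟩
  obtain ⟨m, b, hm, hm_int, hb, hb_int, hbound⟩ := h.2 x₀ y₀ hx hy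
  exact ⟨m, b, hm, hm_int, hb, hb_int, fun k hk => hbound k (hk.trans hn)⟩

variable {N : ℕ} {J : Fin N → Set ℝ} {s : ℝ} {u : Fin N → ℝ}

lemma exists_lt_forall_sub_mem (hJ : ∀ i, IsOpen (J i)) (hu : ∀ i, u i - s ∈ J i) :
    ∃ t < s, ∀ i, u i - t ∈ J i := by
  have hnear : ∀ᶠ t in 𝓝 s, ∀ i, u i - t ∈ J i := eventually_all.2 fun i =>
    (show ContinuousAt (fun t => u i - t) s by fun_prop).eventually ((hJ i).mem_nhds (hu i))
  obtain ⟨t, ht, hts⟩ := ((hnear.filter_mono nhdsWithin_le_nhds).and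
    (self_mem_nhdsWithin : Iio s ∈ 𝓝[<] s)).exists
  exact ⟨t, hts, ht⟩

lemma sub_mem_of_le (hJ : ∀ i, IsLowerSet (J i)) (ht : ∀ i, u i - t ∈ J i) (i : Fin N) {q : ℝ}
    (hq : t ≤ q) : u i - q ∈ J i :=
  hJ i (sub_le_sub_left hq _) (ht i)

lemma exists_decayingKernel_shiftedKernel (hJ_open : ∀ i, IsOpen (J i))
    (hJ_lower : ∀ i, IsLowerSet (J i)) {n : ℕ} {H : Fin N → Fin N → ℝ × ℝ → ℂ}
    (hH : ∀ i j, Decays n (J i) (J j) (H i j)) (ht : ∀ i, u i - t ∈ J i) :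
    ∃ M B, DecayingKernel n t (shiftedKernel H u) M B := by
  have hmem : ∀ i, ∀ q ≥ t, -(q - u i) ∈ J i := fun i q hq => by
    simpa using sub_mem_of_le hJ_lower ht i hq
  choose m b hm hm_int hb hb_int hbound using fun i j =>
    (hH i j).2 (t - u i) (t - u j) (hmem i t le_rfl) (hmem j t le_rfl)
  have hleft : ∀ a : Fin N × Fin N, IsDecayBound t fun x => m a.1 a.2 (x - u a.1) := fun a => by
    simpa using (IsDecayBound.mk (hm a.1 a.2) (hm_int a.1 a.2)).comp_sub_const (u a.1)
  have hright : ∀ a : Fin N × Fin N, IsDecayBound t fun y => b a.1 a.2 (y - u a.2) := fun a => by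
    simpa using (IsDecayBound.mk (hb a.1 a.2) (hb_int a.1 a.2)).comp_sub_const (u a.2)
  refine ⟨_, _, .sum hleft, .sum hright, fun i j x hx y hy => ?_, fun i j k hk x hx y hy => ?_⟩
  · have hsmooth := (hH i j).1.contDiffAt ((isOpen_quadrant (hJ_open i) (hJ_open j)).mem_nhds
      (show (x, y) - (u i, u j) ∈ quadrant (J i) (J j) from ⟨hmem i x hx, hmem j y hy⟩))
    exact ContDiffAt.comp (g := H i j) (x, y) hsmooth (contDiffAt_id.sub contDiffAt_const)
  · have heq : shiftedKernel H u i j = fun p => H i j (p - (u i, u j)) := rfl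
    rw [heq, iteratedFDeriv_comp_sub]
    refine (hbound i j k hk _ (sub_le_sub_right hx _) _ (sub_le_sub_right hy _)).trans ?_
    exact mul_le_mul (IsDecayBound.le_sum hleft (i, j) hx) (IsDecayBound.le_sum hright (i, j) hy)
      ((hright (i, j)).nonneg hy) ((IsDecayBound.sum hleft).nonneg hx)

end Decay

section PartialDerivative

variable {N : ℕ} {φ : (Fin N → ℝ) → ℂ} {u : Fin N → ℝ}

lemma hasDerivAt_comp_update (h : DifferentiableAt ℝ φ u) (k : Fin N) :
    HasDerivAt (fun x => φ (Function.update u k x)) (fderiv ℝ φ u (Pi.single k 1)) (u k) := by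
  have hφ : HasFDerivAt φ (fderiv ℝ φ u) (Function.update u k (u k)) := by
    rw [Function.update_eq_self]
    exact h.hasFDerivAt
  exact hφ.comp_hasDerivAt (u k) (hasDerivAt_update u k (u k))

lemma pd_eq_fderiv (h : DifferentiableAt ℝ φ u) (k : Fin N) :
    pd k φ u = fderiv ℝ φ u (Pi.single k 1) :=
  (hasDerivAt_comp_update h k).deriv

lemma pd_coord_mul (h : DifferentiableAt ℝ φ u) (k : Fin N) {g : ℝ → ℂ} {g' : ℂ}
    (hg : HasDerivAt g g' (u k)) :
    pd k (fun w => g (w k) * φ w) u = g' * φ u + g (u k) * pd k φ u := by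
  have hmul := hg.mul (hasDerivAt_comp_update h k)
  rw [Function.update_eq_self] at hmul
  rw [pd_eq_fderiv h, pd]
  simp only [Function.update_self]
  exact hmul.deriv

lemma sum_eq_add_add_sum_ne {ι E : Type*} [Fintype ι] [DecidableEq ι] [AddCommGroup E]
    (g : ι → E) {i j : ι} (hij : i ≠ j) :
    ∑ l, g l = g i + g j + ∑ l with l ≠ i ∧ l ≠ j, g l := by
  have hfilter : ({l | l ≠ i ∧ l ≠ j} : Finset ι) = (Finset.univ.erase i).erase j := by
    ext l
    simp [and_comm]
  rw [hfilter, add_assoc, Finset.add_sum_erase _ _ (by simp [hij.symm]),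
    Finset.add_sum_erase _ _ (Finset.mem_univ i)]

end PartialDerivative

section GLM

variable {N n : ℕ} {s : ℝ} {H : Fin N → Fin N → ℝ × ℝ → ℂ} {M B : ℝ → ℝ}
  {k : Fin N → Fin N → ℝ → ℂ}

/-- The row of index `i` of a solution `k` on `[s, ∞)` as an element of the row space. -/
def glmRow (s : ℝ) (k : Fin N → Fin N → ℝ → ℂ) (i : Fin N) : RowSpace (Fin N) :=
  toBounded fun y j => k i j (max y s)

lemma IsGLMSolution.glmRow_apply {𝓕 : Fin N → Fin N → ℝ → ℝ → ℂ} (h : IsGLMSolution 𝓕 s k)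
    (i : Fin N) (y : ℝ) (j : Fin N) : glmRow s k i y j = k i j (max y s) := by
  obtain ⟨C, hC⟩ := h.bounded
  have hcont : Continuous fun y j => k i j (max y s) := continuous_pi fun j =>
    (h.continuousOn i j).comp_continuous (by fun_prop) fun y => le_max_right y s
  rw [glmRow, toBounded_apply hcont (C := max C 0) fun y => ?_]
  exact (pi_norm_le_iff_of_nonneg (le_max_right _ _)).2 fun j =>
    (hC i j _ (le_max_right y s)).trans (le_max_left _ _)

lemma IsGLMSolution.glmRow_eq (hH : DecayingKernel (n + 1) s H M B)
    (h : IsGLMSolution (fun i j x y => H i j (x, y)) s k) (i : Fin N) :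
    glmRow s k i = kernelMap H s s (Pi.single i 1) + kernelOp H s (glmRow s k i) := by
  ext y j
  have hrow : EqOn (fun q => ∑ l, glmRow s k i q l * H l j (q, max y s))
      (fun q => ∑ l, k i l q * H l j (q, max y s)) (Ioi s) := fun q hq => by
    simp only [h.glmRow_apply, max_eq_left (le_of_lt (mem_Ioi.1 hq))]
  rw [h.glmRow_apply, h.equation i j _ (le_max_right y s), BoundedContinuousFunction.add_apply,
    Pi.add_apply, kernelMap_apply hH le_rfl, kernelOp_apply hH,
    setIntegral_congr_fun measurableSet_Ioi hrow]
  simp [Pi.single_apply]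

lemma isGLMSolution_of_eq (hH : DecayingKernel (n + 1) s H M B) {κ : Fin N → RowSpace (Fin N)}
    (h : ∀ i, κ i = kernelMap H s s (Pi.single i 1) + kernelOp H s (κ i)) :
    IsGLMSolution (fun i j x y => H i j (x, y)) s fun i j y => κ i y j where
  continuousOn i j := ((continuous_apply j).comp (κ i).continuous).continuousOn
  bounded := ⟨∑ i, ‖κ i‖, fun i j y _ => ((norm_le_pi_norm (κ i y) j).trans
    ((κ i).norm_coe_le_norm y)).trans
      (Finset.single_le_sum (f := fun i => ‖κ i‖) (fun _ _ => norm_nonneg _) (Finset.mem_univ i))⟩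
  equation i j y hy := by
    conv_lhs => rw [h i, BoundedContinuousFunction.add_apply, Pi.add_apply,
      kernelMap_apply hH le_rfl, kernelOp_apply hH, max_eq_left hy]
    simp [Pi.single_apply]

lemma IsUniqueGLMSolution.eq_zero_of_eq_kernelOp (hH : DecayingKernel (n + 1) s H M B)
    (h : IsUniqueGLMSolution (fun i j x y => H i j (x, y)) s k) {κ : RowSpace (Fin N)}
    (hκ : κ = kernelOp H s κ) : κ = 0 := by
  have hsol : IsGLMSolution (fun i j x y => H i j (x, y)) s
      fun i j y => (glmRow s k i + κ) y j := isGLMSolution_of_eq hH fun i => by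
    rw [map_add, ← hκ, ← add_assoc, ← h.1.glmRow_eq hH]
  ext y j
  have hclip : κ y j = κ (max y s) j := by
    rw [hκ, kernelOp_apply hH, kernelOp_apply hH, max_eq_left (le_max_right y s)]
  have huniq := h.2 _ hsol j j (max y s) (le_max_right y s)
  simpa [h.1.glmRow_apply, hclip] using huniq

end GLM

section Rotation

variable {N n : ℕ} {s t : ℝ} {H : Fin N → Fin N → ℝ × ℝ → ℂ} {M B M' B' : ℝ → ℝ}
  {k : (Fin N → ℝ) → Fin N → Fin N → ℝ → ℂ} {u : Fin N → ℝ} {ρ : Fin N → ℝ → ℂ} {i j m : Fin N}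

lemma transform_partialSnd_weightedKernel {G : Fin N → Fin N → ℝ × ℝ → ℂ} {a : ℝ → Fin N → ℂ}
    {C y : ℝ} {ρ' : ℂ} {n' : ℕ} (hG : DecayingKernel (n + 1) t G M B)
    (hW : DecayingKernel (n' + 1) t (weightedKernel ρ G) M' B') (hts : t < s)
    (ha : Measurable a) (hC : ∀ q, ‖a q‖ ≤ C) (hy : s ≤ y) (hρ : HasDerivAt (ρ j) ρ' y) :
    transform (fun l m => partialSnd (weightedKernel ρ G l m)) s a j y
      = transform (fun l m => partialSnd (G l m)) s a j y * ρ j y + transform G s a j y * ρ' := by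
  have hmul : transform (weightedKernel ρ G) s a j = fun y => transform G s a j y * ρ j y :=
    funext fun y => transform_mul_right ρ
  have hderiv := hasDerivAt_transform hW hts ha hC j hy
  rw [hmul] at hderiv
  exact hderiv.unique ((hasDerivAt_transform hG hts ha hC j hy).fun_mul hρ)

/-- The family `k w`, for `w` near `u`, of the unique solutions on `[s, ∞)` of the integral
equations with the kernels `H_ij(x - wⁱ, y - wʲ)`, where the kernel at `u` decays on a larger
half-line `[t, ∞)`. -/
structure IsGLMFamily (H : Fin N → Fin N → ℝ × ℝ → ℂ) (t s : ℝ) (u : Fin N → ℝ) (M B : ℝ → ℝ)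
    (k : (Fin N → ℝ) → Fin N → Fin N → ℝ → ℂ) : Prop where
  decaying : DecayingKernel 2 t (shiftedKernel H u) M B
  lt : t < s
  unique : ∀ᶠ w in 𝓝 u, IsUniqueGLMSolution (fun i j x y => shiftedKernel H w i j (x, y)) s (k w)

namespace IsGLMFamily

lemma glmRow_eq (h : IsGLMFamily H t s u M B k) (i : Fin N) :
    ∀ᶠ w in 𝓝 u, glmRow s (k w) i = kernelMap (shiftedKernel H w) s s (Pi.single i 1)
      + kernelOp (shiftedKernel H w) s (glmRow s (k w) i) := by
  filter_upwards [h.unique, Metric.closedBall_mem_nhds u (sub_pos.2 h.lt)] with w hw hwu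
  exact hw.1.glmRow_eq (h.decaying.shiftedKernel (mem_closedBall_iff_norm.1 hwu)) i

lemma eq_zero_of_eq_kernelOp (h : IsGLMFamily H t s u M B k) (κ : RowSpace (Fin N))
    (hκ : κ = kernelOp (shiftedKernel H u) s κ) : κ = 0 :=
  h.unique.self_of_nhds.eq_zero_of_eq_kernelOp (h.decaying.mono h.lt.le) hκ

lemma glmRow_apply_self (h : IsGLMFamily H t s u M B k) (i j : Fin N) :
    glmRow s (k u) i s j = k u i j s := by
  rw [h.unique.self_of_nhds.1.glmRow_apply, max_self]

lemma isExtendedSolution (h : IsGLMFamily H t s u M B k) (i : Fin N) :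
    IsExtendedSolution (shiftedKernel H u) s i (extendedRow s i (glmRow s (k u) i)) :=
  isExtendedSolution_extendedRow (h.decaying.mono h.lt.le) (h.glmRow_eq i).self_of_nhds

lemma transform_extendedRow_self (h : IsGLMFamily H t s u M B k) (i j : Fin N) :
    transform (shiftedKernel H u) s (extendedRow s i (glmRow s (k u) i)) j s = k u i j s := by
  rw [← h.glmRow_apply_self, ← apply_eq_transform_extendedRow (h.decaying.mono h.lt.le)
    (h.glmRow_eq i).self_of_nhds le_rfl]

lemma hasFDerivAt (h : IsGLMFamily H t s u M B k) (i j : Fin N) :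
    HasFDerivAt (fun w => k w i j s)
      (((ContinuousLinearMap.proj (R := ℝ) (φ := fun _ : Fin N => ℂ) j).comp
        (BoundedContinuousFunction.evalCLM ℝ s)).comp
          (fderiv ℝ (fun w => glmRow s (k w) i) u)) u := by
  have hrow := (differentiableAt_row_and_fderiv_row h.decaying h.lt h.eq_zero_of_eq_kernelOp
    (h.glmRow_eq i)).1.hasFDerivAt
  refine (((ContinuousLinearMap.proj (R := ℝ) (φ := fun _ : Fin N => ℂ) j).comp
    (BoundedContinuousFunction.evalCLM ℝ s)).hasFDerivAt.comp u hrow).congr_of_eventuallyEq ?_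
  filter_upwards [h.unique] with w hw
  simp [hw.1.glmRow_apply]

lemma pd_eq (h : IsGLMFamily H t s u M B k) (hmi : m ≠ i) :
    pd m (fun w => k w i j s) u = k u i m s * k u m j s
      - if j = m then transform (fun l m => partialSnd (shiftedKernel H u l m)) s
          (extendedRow s i (glmRow s (k u) i)) m s else 0 := by
  have hrow := congrArg (fun κ : RowSpace (Fin N) => κ s j)
    (fderiv_row_single h.decaying h.lt h.eq_zero_of_eq_kernelOp h.glmRow_eq hmi)
  simp only [BoundedContinuousFunction.add_apply, Pi.add_apply, max_self,
    columnRow_apply (n := 0) h.decaying h.lt (measurable_extendedRow s i _)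
      (norm_extendedRow_le s i _), h.glmRow_apply_self, BoundedContinuousFunction.coe_smul,
    Pi.smul_apply, smul_eq_mul] at hrow
  rw [pd_eq_fderiv (h.hasFDerivAt i j).differentiableAt, (h.hasFDerivAt i j).fderiv, ← hrow]
  by_cases hjm : j = m <;> simp [hjm]

lemma lame1 (h : IsGLMFamily H t s u M B k) : Lame1 (fun i j w => k w j i s) u :=
  fun i j m _ him hjm => by rw [h.pd_eq hjm.symm, if_neg him, sub_zero, mul_comm]

lemma weight_mul_pd_weight_mul_add (h : IsGLMFamily H t s u M B k)
    (hW : DecayingKernel (n + 1) t (weightedKernel ρ (shiftedKernel H u)) M' B')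
    {ρ' : Fin N → ℂ} (hρ : ∀ i, HasDerivAt (ρ i) (ρ' i) s)
    (hskew : ∀ l m, ∀ p ≥ s, ∀ q ≥ s,
      ρ m q * partialSnd (weightedKernel ρ (shiftedKernel H u) l m) (p, q)
        = -(ρ l p * partialSnd (weightedKernel ρ (shiftedKernel H u) m l) (q, p)))
    (hij : i ≠ j) :
    ρ i s * (ρ i s * pd i (fun w => k w j i s) u - ρ' i * k u j i s)
      + ρ j s * (ρ j s * pd j (fun w => k w i j s) u - ρ' j * k u i j s)
      + ∑ l with l ≠ i ∧ l ≠ j, ρ l s ^ 2 * k u i l s * k u j l s = 0 := by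
  have hquad := (h.isExtendedSolution i).weight_mul_transform_add (h.isExtendedSolution j) hW h.lt
    hskew
  have hweighted : ∀ i j, transform (weightedKernel ρ (shiftedKernel H u)) s
      (extendedRow s i (glmRow s (k u) i)) j s = k u i j s * ρ j s := fun i j => by
    rw [← h.transform_extendedRow_self]
    exact transform_mul_right ρ
  simp only [hweighted, transform_partialSnd_weightedKernel h.decaying hW h.lt
    (measurable_extendedRow s _ _) (norm_extendedRow_le s _ _) le_rfl (hρ _),
    h.transform_extendedRow_self] at hquad
  have hsum : ∑ l with l ≠ i ∧ l ≠ j, ρ l s ^ 2 * k u i l s * k u j l s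
      = ∑ l with l ≠ i ∧ l ≠ j, k u i l s * ρ l s * (k u j l s * ρ l s) :=
    Finset.sum_congr rfl fun l _ => by ring
  rw [sum_eq_add_add_sum_ne _ hij, ← hsum] at hquad
  rw [h.pd_eq hij, h.pd_eq hij.symm, if_pos rfl, if_pos rfl]
  linear_combination -hquad

lemma lame3 (h : IsGLMFamily H t s u M B k) {r : Fin N → ℝ → ℂ}
    (hr : ∀ i, DifferentiableAt ℝ (r i) (u i - s))
    (hW : DecayingKernel (n + 1) t
      (weightedKernel (fun i q => r i (u i - q)) (shiftedKernel H u)) M' B')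
    (hskew : ∀ l m, ∀ p ≥ s, ∀ q ≥ s, r m (u m - q)
        * partialSnd (weightedKernel (fun i q => r i (u i - q)) (shiftedKernel H u) l m) (p, q)
      = -(r l (u l - p)
        * partialSnd (weightedKernel (fun i q => r i (u i - q)) (shiftedKernel H u) m l) (q, p))) :
    Lame3 (fun i x => r i (x - s) ^ 2) (fun i x => r i (x - s)) (fun i j w => k w j i s) u := by
  intro i j hij
  have hweight : ∀ i, HasDerivAt (fun q => r i (u i - q)) (-deriv (r i) (u i - s)) s := fun i =>
    (hr i).hasDerivAt.comp_const_sub (u i) s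
  have hshift : ∀ i, HasDerivAt (fun x => r i (x - s)) (deriv (r i) (u i - s)) (u i) := fun i =>
    (hr i).hasDerivAt.comp_sub_const (u i) s
  have hquad := h.weight_mul_pd_weight_mul_add hW hweight hskew hij
  simp only
  rw [pd_coord_mul (h.hasFDerivAt j i).differentiableAt i (hshift i),
    pd_coord_mul (h.hasFDerivAt i j).differentiableAt j (hshift j)]
  linear_combination hquad

end IsGLMFamily

end Rotation

section Dressing

variable {N n : ℕ} {J : Fin N → Set ℝ} {s t : ℝ} {u : Fin N → ℝ} {M B : ℝ → ℝ}
  {r : Fin N → ℝ → ℂ} {F : Fin N → Fin N → ℝ → ℝ → ℂ}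

/-- The functions `F_ij(x, y)` as functions of the point `(x, y)` of the plane. -/
def planeFun (F : Fin N → Fin N → ℝ → ℝ → ℂ) (i j : Fin N) (p : ℝ × ℝ) : ℂ := F i j p.1 p.2

lemma weightedKernel_shiftedKernel (r : Fin N → ℝ → ℂ) (F : Fin N → Fin N → ℝ → ℝ → ℂ)
    (u : Fin N → ℝ) :
    weightedKernel (fun i q => r i (u i - q)) (shiftedKernel (planeFun F) u)
      = shiftedKernel (fun i j p => F i j p.1 p.2 * r j (-p.2)) u := by
  ext i j p
  simp [weightedKernel, shiftedKernel, planeFun]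

lemma ZakharovRelation.weight_mul_partialSnd_eq_neg (hZ : ZakharovRelation J (rescaledDressing r F))
    (hW : DecayingKernel (n + 1) t
      (weightedKernel (fun i q => r i (u i - q)) (shiftedKernel (planeFun F) u)) M B)
    (hJ : ∀ i, ∀ q ≥ t, u i - q ∈ J i) (hr_ne : ∀ i, ∀ x ∈ J i, r i x ≠ 0) (l m : Fin N)
    {p q : ℝ} (hp : t ≤ p) (hq : t ≤ q) :
    r m (u m - q) * partialSnd
        (weightedKernel (fun i q => r i (u i - q)) (shiftedKernel (planeFun F) u) l m) (p, q)
      = -(r l (u l - p) * partialSnd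
        (weightedKernel (fun i q => r i (u i - q)) (shiftedKernel (planeFun F) u) m l) (q, p)) := by
  set W := weightedKernel (fun i q => r i (u i - q)) (shiftedKernel (planeFun F) u)
  have hderiv : ∀ l m, ∀ p ≥ t, ∀ q ≥ t, deriv (fun q => rescaledDressing r F l m p q u) q
      = partialSnd (W l m) (p, q) / r l (u l - p) := fun l m p hp q hq => by
    have hdiv : (fun q => rescaledDressing r F l m p q u)
        = fun q => W l m (p, q) / r l (u l - p) := by
      ext q
      simp only [rescaledDressing, W, weightedKernel, shiftedKernel, planeFun, Prod.mk_sub_mk]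
      ring
    rw [hdiv]
    exact ((hasDerivAt_partialSnd (hW.differentiableAt l m hp hq)).div_const _).deriv
  have hzak := hZ l m u p q (hJ l p hp) (hJ m q hq)
  rw [hderiv l m p hp q hq, hderiv m l q hq p hp] at hzak
  have hl : r l (u l - p) ≠ 0 := hr_ne l _ (hJ l p hp)
  have hm : r m (u m - q) ≠ 0 := hr_ne m _ (hJ m q hq)
  field_simp at hzak
  linear_combination hzak

lemma dressing_lame (hJ_open : ∀ i, IsOpen (J i)) (hJ_lower : ∀ i, IsLowerSet (J i))
    (hr : ∀ i, ∀ x ∈ J i, DifferentiableAt ℝ (r i) x) (hr_ne : ∀ i, ∀ x ∈ J i, r i x ≠ 0)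
    (hF : ∀ i j, Decays 2 (J i) (J j) (fun p => F i j p.1 p.2))
    (hFr : ∀ i j, Decays 1 (J i) (J j) (fun p => F i j p.1 p.2 * r j (-p.2)))
    (hZ : ZakharovRelation J (rescaledDressing r F)) {W : Set (ℝ × (Fin N → ℝ))}
    {K : Fin N → Fin N → ℝ → ℝ → (Fin N → ℝ) → ℂ} (hW : IsOpen W)
    (hWJ : ∀ s u, (s, u) ∈ W → ∀ i, u i - s ∈ J i)
    (hK : ∀ s u, (s, u) ∈ W → IsUniqueGLMSolution (fun i j q q' => dressing F i j q q' u) s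
      (fun i j s' => K i j s s' u)) (hsu : (s, u) ∈ W) :
    (∀ i j, DifferentiableAt ℝ (rotationCoeff K s i j) u) ∧ Lame1 (rotationCoeff K s) u ∧
      Lame3 (fun i x => r i (x - s) ^ 2) (fun i x => r i (x - s)) (rotationCoeff K s) u := by
  obtain ⟨t, hts, ht⟩ := exists_lt_forall_sub_mem hJ_open (hWJ s u hsu)
  obtain ⟨M, B, hdecay⟩ :=
    exists_decayingKernel_shiftedKernel (H := planeFun F) hJ_open hJ_lower hF ht
  obtain ⟨M', B', hdecay'⟩ := exists_decayingKernel_shiftedKernel hJ_open hJ_lower hFr ht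
  rw [← weightedKernel_shiftedKernel] at hdecay'
  have hnear : ∀ᶠ w in 𝓝 u, (s, w) ∈ W :=
    (show ContinuousAt (fun w => (s, w)) u by fun_prop).eventually (hW.mem_nhds hsu)
  have hfamily : IsGLMFamily (planeFun F) t s u M B fun w i j s' => K i j s s' w :=
    ⟨hdecay, hts, hnear.mono fun w hw => hK s w hw⟩
  have hskew := fun l m p (hp : s ≤ p) q (hq : s ≤ q) => hZ.weight_mul_partialSnd_eq_neg hdecay'
    (fun i q => sub_mem_of_le hJ_lower ht i) hr_ne l m (hts.le.trans hp) (hts.le.trans hq)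
  exact ⟨fun i j => (hfamily.hasFDerivAt j i).differentiableAt, hfamily.lame1,
    hfamily.lame3 (fun i => hr i _ (hWJ s u hsu i)) hdecay' hskew⟩

end Dressing

section Generating

section ShiftedPlaneFunction

variable {N : ℕ} {i j : Fin N} {u : Fin N → ℝ} {s s' a b : ℝ} {g : ℝ × ℝ → ℂ}

lemma deriv_deriv_comp_sub (hg : ContDiffAt ℝ 2 g (s - a, s' - b)) :
    deriv (fun x => deriv (fun y => g (x - a, y - b)) s') s
      = partialSnd (partialFst g) (s - a, s' - b) := by
  refine (EventuallyEq.deriv_eq ?_).trans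
    ((hasDerivAt_partialFst_partialSnd hg).comp_sub_const s a).deriv
  have hnear : ∀ᶠ x in 𝓝 s, ContDiffAt ℝ 2 g (x - a, s' - b) :=
    (show ContinuousAt (fun x => (x - a, s' - b)) s by fun_prop).eventually
      (hg.eventually (by simp))
  filter_upwards [hnear] with x hx
  exact ((hasDerivAt_partialSnd (hx.differentiableAt two_ne_zero)).comp_sub_const s' b).deriv

lemma pd_comp_const_sub_fst (hij : i ≠ j) (hg : DifferentiableAt ℝ g (s - u i, s' - u j)) :
    pd i (fun w => g (s - w i, s' - w j)) u = -partialFst g (s - u i, s' - u j) := by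
  rw [← ((hasDerivAt_partialFst hg).comp_const_sub s (u i)).deriv, pd]
  simp [hij.symm]

lemma pd_comp_const_sub_snd (hij : i ≠ j) (hg : DifferentiableAt ℝ g (s - u i, s' - u j)) :
    pd j (fun w => g (s - w i, s' - w j)) u = -partialSnd g (s - u i, s' - u j) := by
  rw [← ((hasDerivAt_partialSnd hg).comp_const_sub s' (u j)).deriv, pd]
  simp [hij]

lemma pd_pd_comp_const_sub (hij : i ≠ j) (hg : ContDiffAt ℝ 2 g (s - u i, s' - u j)) :
    pd i (pd j (fun w => g (s - w i, s' - w j))) u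
      = partialSnd (partialFst g) (s - u i, s' - u j) := by
  have hmixed := ((hasDerivAt_partialFst_partialSnd hg).comp_const_sub s (u i)).neg
  rw [neg_neg] at hmixed
  refine (EventuallyEq.deriv_eq ?_).trans hmixed.deriv
  have hnear : ∀ᶠ x in 𝓝 (u i), ContDiffAt ℝ 2 g (s - x, s' - u j) :=
    (show ContinuousAt (fun x => (s - x, s' - u j)) (u i) by fun_prop).eventually
      (hg.eventually (by simp))
  filter_upwards [hnear] with x hx
  rw [pd_comp_const_sub_snd hij (by simpa [hij.symm] using hx.differentiableAt two_ne_zero)]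
  simp [hij.symm]

end ShiftedPlaneFunction

variable {N : ℕ} {J : Fin N → Set ℝ} {f r : Fin N → ℝ → ℂ} {F Φ : Fin N → Fin N → ℝ → ℝ → ℂ}
  {i j : Fin N} {x y : ℝ}

namespace Generates

lemma contDiffAt (h : Generates J Φ F) (hJ : ∀ i, IsOpen (J i)) (hij : i ≤ j)
    (hx : -x ∈ J i) (hy : -y ∈ J j) : ContDiffAt ℝ 2 (planeFun Φ i j) (x, y) :=
  (h.smooth i j hij).contDiffAt ((isOpen_quadrant (hJ i) (hJ j)).mem_nhds ⟨hx, hy⟩)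

lemma differentiableAt (h : Generates J Φ F) (hJ : ∀ i, IsOpen (J i)) (hij : i ≤ j)
    (hx : -x ∈ J i) (hy : -y ∈ J j) : DifferentiableAt ℝ (planeFun Φ i j) (x, y) :=
  (h.contDiffAt hJ hij hx hy).differentiableAt two_ne_zero

lemma eq_partialFst (h : Generates J Φ F) (hJ : ∀ i, IsOpen (J i)) (hij : i ≤ j)
    (hx : -x ∈ J i) (hy : -y ∈ J j) : F i j x y = partialFst (planeFun Φ i j) (x, y) := by
  have hupper := h.upper i j hij 0 x y (by simpa using hx) (by simpa using hy)
  simp only [Pi.zero_apply, sub_zero] at hupper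
  rw [hupper]
  exact (hasDerivAt_partialFst (h.differentiableAt hJ hij hx hy)).deriv

lemma eq_neg_partialSnd (h : Generates J Φ F) (hJ : ∀ i, IsOpen (J i)) (hij : i ≤ j)
    (hx : -x ∈ J i) (hy : -y ∈ J j) : F j i y x = -partialSnd (planeFun Φ i j) (x, y) := by
  have hsnd := hasDerivAt_partialSnd (h.differentiableAt hJ hij hx hy)
  rcases hij.lt_or_eq with hlt | rfl
  · have hlower := h.lower i j hlt 0 y x (by simpa using hy) (by simpa using hx)
    simp only [Pi.zero_apply, sub_zero] at hlower
    rw [hlower, ← hsnd.deriv]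
    rfl
  · rw [h.eq_partialFst hJ le_rfl hy hx]
    have hfst := hasDerivAt_partialFst (h.differentiableAt hJ le_rfl hy hx)
    refine hfst.unique (hsnd.neg.congr_of_eventuallyEq ?_)
    filter_upwards [continuousAt_neg.eventually ((hJ i).mem_nhds hy)] with t ht
    exact h.skew i t x ht hx

lemma hasDerivAt_upper (h : Generates J Φ F) (hJ : ∀ i, IsOpen (J i)) (hij : i ≤ j)
    (hx : -x ∈ J i) (hy : -y ∈ J j) :
    HasDerivAt (F i j x) (partialSnd (partialFst (planeFun Φ i j)) (x, y)) y := by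
  refine (hasDerivAt_partialSnd_partialFst (h.contDiffAt hJ hij hx hy)).congr_of_eventuallyEq ?_
  filter_upwards [continuousAt_neg.eventually ((hJ j).mem_nhds hy)] with t ht
  exact h.eq_partialFst hJ hij hx ht

lemma hasDerivAt_lower (h : Generates J Φ F) (hJ : ∀ i, IsOpen (J i)) (hij : i ≤ j)
    (hx : -x ∈ J i) (hy : -y ∈ J j) :
    HasDerivAt (F j i y) (-partialSnd (partialFst (planeFun Φ i j)) (x, y)) x := by
  refine (hasDerivAt_partialFst_partialSnd
    (h.contDiffAt hJ hij hx hy)).neg.congr_of_eventuallyEq ?_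
  filter_upwards [continuousAt_neg.eventually ((hJ i).mem_nhds hx)] with t ht
  exact h.eq_neg_partialSnd hJ hij ht hy

end Generates

lemma zakharovRelation_iff_forall_le {𝓕 : Fin N → Fin N → ℝ → ℝ → (Fin N → ℝ) → ℂ} :
    ZakharovRelation J 𝓕 ↔ ∀ i j, i ≤ j → ∀ (u : Fin N → ℝ) (s s' : ℝ),
      u i - s ∈ J i → u j - s' ∈ J j →
      deriv (fun t => 𝓕 i j s t u) s' + deriv (fun t => 𝓕 j i s' t u) s = 0 := by
  refine ⟨fun h i j _ => h i j, fun h i j u s s' hs hs' => ?_⟩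
  rcases le_total i j with hij | hij
  · exact h i j hij u s s' hs hs'
  · rw [add_comm]
    exact h j i hij u s' s hs' hs

lemma Generates.zakharovRelation_dressing (h : Generates J Φ F) (hJ : ∀ i, IsOpen (J i)) :
    ZakharovRelation J (dressing F) := by
  refine zakharovRelation_iff_forall_le.2 fun i j hij u s s' hs hs' => ?_
  rw [← neg_sub] at hs hs'
  simp only [dressing]
  rw [((h.hasDerivAt_upper hJ hij hs hs').comp_sub_const s' (u j)).deriv,
    ((h.hasDerivAt_lower hJ hij hs hs').comp_sub_const s (u i)).deriv, add_neg_cancel]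

/-- The linear equation satisfied by `g = Φ_ij`, `i ≤ j`, at the point `p = (s - uⁱ, s' - uʲ)`,
with `a = fⁱ` and `b = fʲ`; it covers both the off-diagonal and the diagonal equations. -/
def GeneratingEq (a b : ℝ → ℂ) (g : ℝ × ℝ → ℂ) (p : ℝ × ℝ) : Prop :=
  2 * partialSnd (partialFst g) p * (a (-p.1) - b (-p.2))
    + partialFst g p * deriv b (-p.2) - partialSnd g p * deriv a (-p.1) = 0

namespace Generates

lemma zakharovRelation_rescaledDressing_iff (h : Generates J Φ F) (hJ : ∀ i, IsOpen (J i))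
    (hr : ∀ i, ∀ x ∈ J i, HasDerivAt (r i) (deriv (f i) x / (2 * r i x)) x)
    (hr_ne : ∀ i, ∀ x ∈ J i, r i x ≠ 0) (hr_sq : ∀ i, ∀ x ∈ J i, r i x ^ 2 = f i x) :
    ZakharovRelation J (rescaledDressing r F) ↔ ∀ i j, i ≤ j → ∀ (u : Fin N → ℝ) (s s' : ℝ),
      u i - s ∈ J i → u j - s' ∈ J j →
      GeneratingEq (f i) (f j) (planeFun Φ i j) (s - u i, s' - u j) := by
  refine zakharovRelation_iff_forall_le.trans (forall₄_congr fun i j hij u =>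
    forall₄_congr fun s s' hs hs' => ?_)
  have hx : -(s - u i) ∈ J i := by rwa [neg_sub]
  have hy : -(s' - u j) ∈ J j := by rwa [neg_sub]
  have hupper := (((hr j _ hs').comp_const_sub (u j) s').div_const (r i (u i - s))).fun_mul
    ((h.hasDerivAt_upper hJ hij hx hy).comp_sub_const s' (u j))
  have hlower := (((hr i _ hs).comp_const_sub (u i) s).div_const (r j (u j - s'))).fun_mul
    ((h.hasDerivAt_lower hJ hij hx hy).comp_sub_const s (u i))
  have hri : r i (u i - s) ≠ 0 := hr_ne i _ hs
  have hrj : r j (u j - s') ≠ 0 := hr_ne j _ hs'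
  simp only [rescaledDressing]
  rw [hupper.deriv, hlower.deriv, GeneratingEq, neg_sub, neg_sub, ← hr_sq i _ hs,
    ← hr_sq j _ hs', h.eq_partialFst hJ hij hx hy, h.eq_neg_partialSnd hJ hij hx hy]
  -- The linear equation is the relation multiplied by `-2 √fⁱ √fʲ`.
  rw [← mul_right_inj' (mul_ne_zero (mul_ne_zero (neg_ne_zero.2 two_ne_zero) hri) hrj), mul_zero]
  refine Eq.congr_left ?_
  field_simp
  ring

lemma linearOffDiag_iff (h : Generates J Φ F) (hJ : ∀ i, IsOpen (J i)) :
    LinearOffDiag J f Φ ↔ ∀ i j, i < j → ∀ (u : Fin N → ℝ) (s s' : ℝ),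
      u i - s ∈ J i → u j - s' ∈ J j →
      GeneratingEq (f i) (f j) (planeFun Φ i j) (s - u i, s' - u j) := by
  refine forall₄_congr fun i j hij u => forall₄_congr fun s s' hs hs' => ?_
  have hsmooth : ContDiffAt ℝ 2 (planeFun Φ i j) (s - u i, s' - u j) :=
    h.contDiffAt hJ hij.le (by rwa [neg_sub]) (by rwa [neg_sub])
  have hdiff := hsmooth.differentiableAt two_ne_zero
  change 2 * pd i (pd j fun w => planeFun Φ i j (s - w i, s' - w j)) u * _
    + pd j (fun w => planeFun Φ i j (s - w i, s' - w j)) u * _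
    - pd i (fun w => planeFun Φ i j (s - w i, s' - w j)) u * _ = 0 ↔ _
  rw [pd_pd_comp_const_sub hij.ne hsmooth, pd_comp_const_sub_fst hij.ne hdiff,
    pd_comp_const_sub_snd hij.ne hdiff, deriv_comp_sub_const, deriv_comp_sub_const, GeneratingEq,
    neg_sub, neg_sub]
  refine Eq.congr_left ?_
  ring

lemma linearDiag_iff (h : Generates J Φ F) (hJ : ∀ i, IsOpen (J i)) :
    LinearDiag J f Φ ↔ ∀ i, ∀ (u : Fin N → ℝ) (s s' : ℝ), u i - s ∈ J i → u i - s' ∈ J i →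
      GeneratingEq (f i) (f i) (planeFun Φ i i) (s - u i, s' - u i) := by
  refine forall₂_congr fun i u => forall₄_congr fun s s' hs hs' => ?_
  have hsmooth : ContDiffAt ℝ 2 (planeFun Φ i i) (s - u i, s' - u i) :=
    h.contDiffAt hJ le_rfl (by rwa [neg_sub]) (by rwa [neg_sub])
  have hdiff := hsmooth.differentiableAt two_ne_zero
  change 2 * deriv (fun x => deriv (fun y => planeFun Φ i i (x - u i, y - u i)) s') s * _
    - deriv (fun x => planeFun Φ i i (x - u i, s' - u i)) s * _
    + deriv (fun y => planeFun Φ i i (s - u i, y - u i)) s' * _ = 0 ↔ _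
  rw [deriv_deriv_comp_sub hsmooth, ((hasDerivAt_partialFst hdiff).comp_sub_const s (u i)).deriv,
    ((hasDerivAt_partialSnd hdiff).comp_sub_const s' (u i)).deriv, deriv_comp_const_sub,
    deriv_comp_const_sub, GeneratingEq, neg_sub, neg_sub]
  refine Eq.congr_left ?_
  ring

lemma linearOffDiag_and_linearDiag_iff (h : Generates J Φ F) (hJ : ∀ i, IsOpen (J i)) :
    LinearOffDiag J f Φ ∧ LinearDiag J f Φ ↔ ∀ i j, i ≤ j → ∀ (u : Fin N → ℝ) (s s' : ℝ),
      u i - s ∈ J i → u j - s' ∈ J j →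
      GeneratingEq (f i) (f j) (planeFun Φ i j) (s - u i, s' - u j) := by
  rw [h.linearOffDiag_iff hJ, h.linearDiag_iff hJ]
  refine ⟨fun ⟨hoff, hdiag⟩ i j hij => ?_,
    fun hall => ⟨fun i j hij => hall i j hij.le, fun i => hall i i le_rfl⟩⟩
  rcases hij.lt_or_eq with hlt | rfl
  exacts [hoff i j hlt, hdiag i]

end Generates

end Generating

end

theorem mainTheorem10 (N : ℕ) (J : Fin N → Set ℝ)
    (hJ_open : ∀ i, IsOpen (J i)) (hJ_lower : ∀ i, IsLowerSet (J i))
    (f r : Fin N → ℝ → ℂ)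
    (hf : ∀ i, ContDiffOn ℝ 1 (f i) (J i)) (hf_ne : ∀ i, ∀ x ∈ J i, f i x ≠ 0)
    (hr : ∀ i, ContinuousOn (r i) (J i)) (hr_sq : ∀ i, ∀ x ∈ J i, r i x ^ 2 = f i x) :
    (∀ F : Fin N → Fin N → ℝ → ℝ → ℂ,
      (∀ i j, Decays 2 (J i) (J j) (fun p => F i j p.1 p.2)) →
      (∀ i j, Decays 1 (J i) (J j) (fun p => F i j p.1 p.2 * r j (-p.2))) →
      ZakharovRelation J (dressing F) →
      ZakharovRelation J (rescaledDressing r F) →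
      ∀ (W : Set (ℝ × (Fin N → ℝ))) (K : Fin N → Fin N → ℝ → ℝ → (Fin N → ℝ) → ℂ),
        IsOpen W →
        (∀ s u, (s, u) ∈ W → ∀ i, u i - s ∈ J i) →
        (∀ s u, (s, u) ∈ W →
          IsUniqueGLMSolution (fun i j q q' => dressing F i j q q' u) s
            (fun i j s' => K i j s s' u)) →
        ∀ s u, (s, u) ∈ W →
          (∀ i j, DifferentiableAt ℝ (rotationCoeff K s i j) u) ∧
          Lame1 (rotationCoeff K s) u ∧
          Lame2 (rotationCoeff K s) u ∧
          Lame3 (fun i x => f i (x - s)) (fun i x => r i (x - s)) (rotationCoeff K s) u) ∧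
    (∀ F Φ : Fin N → Fin N → ℝ → ℝ → ℂ, Generates J Φ F →
      ZakharovRelation J (dressing F) ∧
      (ZakharovRelation J (rescaledDressing r F) ↔
        LinearOffDiag J f Φ ∧ LinearDiag J f Φ)) := by
  have hr_ne : ∀ i, ∀ x ∈ J i, r i x ≠ 0 := fun i x hx h0 =>
    hf_ne i x hx (by rw [← hr_sq i x hx, h0, zero_pow two_ne_zero])
  have hr_deriv : ∀ i, ∀ x ∈ J i, HasDerivAt (r i) (deriv (f i) x / (2 * r i x)) x :=
    fun i x hx => hasDerivAt_of_sq_eq (hJ_open i) (hr i) (hr_sq i) hx (hr_ne i x hx)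
      (((hf i).contDiffAt ((hJ_open i).mem_nhds hx)).differentiableAt one_ne_zero).hasDerivAt
  refine ⟨fun F hF hFr hZ hZr W K hW hWJ hK s u hsu => ?_, fun F Φ h => ?_⟩
  · obtain ⟨hdiff, hlame1, hlame3⟩ := dressing_lame hJ_open hJ_lower
      (fun i x hx => (hr_deriv i x hx).differentiableAt) hr_ne hF hFr hZr hW hWJ hK hsu
    have hZ_one : ZakharovRelation J (rescaledDressing (fun _ _ => 1) F) := by
      simpa [ZakharovRelation, rescaledDressing, dressing] using hZ
    obtain ⟨-, -, hlame2⟩ := dressing_lame hJ_open hJ_lower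
      (fun _ _ _ => differentiableAt_const _) (fun _ _ _ => one_ne_zero) hF
      (fun i j => by simpa using (hF i j).mono one_le_two) hZ_one hW hWJ hK hsu
    refine ⟨hdiff, hlame1, fun i j hij => by simpa using hlame2 i j hij, fun i j hij => ?_⟩
    simpa only [hr_sq _ _ (hWJ s u hsu _)] using hlame3 i j hij
  · refine ⟨h.zakharovRelation_dressing hJ_open, ?_⟩
    rw [h.zakharovRelation_rescaledDressing_iff hJ_open hr_deriv hr_ne hr_sq,
      h.linearOffDiag_and_linearDiag_iff hJ_open]
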